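/- Let $\mathbf k$ be a field of characteristic $0$ and $\lambda\in\mathbf k$. A (unital) differential algebra of weight $\lambda$ is an associative unital $\mathbf k$-algebra with a linear operator $d$ such that $d(uv)=d(u)v+u\,d(v)+\lambda d(u)d(v)$ and $d(1)=0$; morphisms are (unital) algebra homomorphisms commuting with the operators. For an algebra $A$, $\mathcal D_\lambda(A)$ denotes the free differential algebra of weight $\lambda$ on $A$ (the value at $A$ of the left adjoint of the forgetful functor to algebras), and for commutative $A$, $\mathcal{CD}_\lambda(A)$ denotes the analogous free object among commutative differential algebras of weight $\lambda$. Let $\Delta(x)=\{x^{(m)}\mid m\ge 0\}$. The noncommutative polynomial algebra $\mathbf k\langle\Delta(x)\rangle$ and the polynomial algebra $\mathbf k[\Delta(x)]$ carry the weight $\lambda$ derivation $d$ with $d(x^{(m)})=x^{(m+1)}$. Order the letters by $x^{(0)}\prec x^{(1)}\prec\cdots$, words by the deg-lex order (longer words are larger, words of equal length are compared lexicographically from the left), and commutative words in the same way after writing their letters in descending order. Let $\bar f$ denote the leading word and $f^\natural$ the quotient of $f\ne0$ by its leading coefficient. A set $S$ of monic elements of $\mathbf k\langle\Delta(x)\rangle$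 is a (differential) Gröbner–Shirshov basis if, for all $f,g\in S$, $i,j\ge 0$ and words $u,v,a,b,w$, the element $d^i(f)^\natural u-v\,d^j(g)^\natural$ whenever $w=\overline{d^i(f)}u=v\overline{d^j(g)}$ and $|w|<|\bar f|+|\bar g|$, and the element $d^i(f)^\natural-a\,d^j(g)^\natural b$ whenever $w=\overline{d^i(f)}=a\overline{d^j(g)}b$, are linear combinations of elements $a'd^r(s)b'$ with $s\in S$, $r\ge0$, $a',b'$ words and $a'\overline{d^r(s)}b'\prec w$. In $\mathbf k[\Delta(x)]$ the definition is the same, with the compositions $d^i(f)^\natural u-d^j(g)^\natural v$ for $w=\overline{d^i(f)}u=\overline{d^j(g)}v$, $|w|<|\bar f|+|\bar g|$. $\mathrm{DIrr}(S)$ is the set of (commutative) words that contain no $\overline{d^r(s)}$, $s\in S$, $r\ge 0$, as a subword (factor). Let $C_n$ be the cyclic group of order $n\ge 2$, and $\hat S=\{(x^{(0)})^n-1\}$. (1) For every $\lambda$, $$\mathcal D_\lambda(\mathbf kC_n)\cong\mathbf k\langle\Delta(x)\rangle/\bigl(d^m((x^{(0)})^n)-\delta_{m,0}\mid m\ge0\bigr)$$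 as differential algebras, with a generator of $C_n$ corresponding to the class of $x^{(0)}$ and the ideal being the differential ideal generated by $\hat S$. The set $\hat S$ is a Gröbner–Shirshov basis in $\mathbf k\langle\Delta(x)\rangle$, and $$\mathrm{DIrr}(\hat S)=\{\mathfrak x \mid x^{(m)}\bigl(x^{(m(1-\delta_{\lambda,0}))}\bigr)^{n-1}\text{ is not a subword of }\mathfrak x\text{ for any }m\ge0\}$$ is a $\mathbf k$-basis of $\mathcal D_\lambda(\mathbf kC_n)$. (2) For every $\lambda$, $$\mathcal{CD}_\lambda(\mathbf kC_n)\cong\mathbf k[\Delta(x)]/\bigl(d^m((x^{(0)})^n)-\delta_{m,0}\mid m\ge0\bigr)$$ in the same sense. If $\lambda\ne0$, then $\hat S$ is a Gröbner–Shirshov basis in $\mathbf k[\Delta(x)]$, and $$\mathrm{DIrr}(\hat S)=\Bigl\{\prod_{i\ge0}(x^{(i)})^{n_i}\Bigm| 0\le n_i\le n-1,\ \sum_i n_i<\infty\Bigr\}$$ is a $\mathbf k$-basis of $\mathcal{CD}_\lambda(\mathbf kC_n)$. -/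

import Mathlib

namespace DiffGS

/-! ## Differential algebras of weight `lam` and free differential algebras -/

section Differential

variable {k : Type*} [Field k]

/-- `d` is a derivation of weight `lam` on the unital `k`-algebra `R`. -/
structure IsWeightedDerivation {R : Type*} [Ring R] [Algebra k R] (lam : k) (d : R →ₗ[k] R) :
    Prop where
  leibniz : ∀ x y : R, d (x * y) = d x * y + x * d y + lam • (d x * d y)
  map_one : d 1 = 0

/-- `(F, dF)` together with the algebra homomorphism `i : A → F` is a free differential algebra of
weight `lam` on the algebra `A` (universal property against differential algebras in `Type v`). -/
structure IsFreeDifferentialAlgebra.{v, u, a, f} {k : Type u} [Field k] {A : Type a} [Ring A]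
    [Algebra k A] {F : Type f} [Ring F] [Algebra k F] (lam : k) (dF : F →ₗ[k] F)
    (i : A →ₐ[k] F) : Prop where
  derivation : IsWeightedDerivation lam dF
  universal : ∀ (R : Type v) [Ring R] [Algebra k R] (d : R →ₗ[k] R), IsWeightedDerivation lam d →
    ∀ φ : A →ₐ[k] R, ∃! ψ : F →ₐ[k] R, (∀ x, ψ (dF x) = d (ψ x)) ∧ ψ.comp i = φ

/-- `(F, dF)` together with the algebra homomorphism `i : A → F` is a free commutative differential
algebra of weight `lam` on the algebra `A`
(universal property against commutative differential algebras in `Type v`). -/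
structure IsFreeCommDifferentialAlgebra.{v, u, a, f} {k : Type u} [Field k] {A : Type a} [Ring A]
    [Algebra k A] {F : Type f} [CommRing F] [Algebra k F] (lam : k) (dF : F →ₗ[k] F)
    (i : A →ₐ[k] F) : Prop where
  derivation : IsWeightedDerivation lam dF
  universal : ∀ (R : Type v) [CommRing R] [Algebra k R] (d : R →ₗ[k] R),
    IsWeightedDerivation lam d →
    ∀ φ : A →ₐ[k] R, ∃! ψ : F →ₐ[k] R, (∀ x, ψ (dF x) = d (ψ x)) ∧ ψ.comp i = φ

variable {R : Type*} [Ring R] [Algebra k R]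

/-- The differential ideal generated by `U`: the smallest two-sided ideal that contains `U` and is
stable under `d`. -/
def differentialIdeal (d : R →ₗ[k] R) (U : Set R) : Ideal R :=
  sInf {I : Ideal R | I.IsTwoSided ∧ U ⊆ I ∧ ∀ x ∈ I, d x ∈ I}

instance differentialIdeal_isTwoSided (d : R →ₗ[k] R) (U : Set R) :
    (differentialIdeal d U).IsTwoSided := by
  constructor
  intro a b ha
  simp only [differentialIdeal, Submodule.mem_sInf] at ha ⊢
  intro I hI
  have := hI.1
  exact Ideal.mul_mem_right b I (ha I hI)

theorem map_mem_differentialIdeal (d : R →ₗ[k] R) (U : Set R) {x : R}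
    (hx : x ∈ differentialIdeal d U) : d x ∈ differentialIdeal d U := by
  simp only [differentialIdeal, Submodule.mem_sInf] at hx ⊢
  exact fun I hI => hI.2.2 x (hx I hI)

/-- The quotient algebra of `R` by the differential ideal generated by `U`. -/
abbrev DiffQuotient (d : R →ₗ[k] R) (U : Set R) : Type _ := R ⧸ differentialIdeal d U

/-- The projection onto the quotient by the differential ideal generated by `U`. -/
def toDiffQuotient (d : R →ₗ[k] R) (U : Set R) : R →ₐ[k] DiffQuotient d U :=
  Ideal.Quotient.mkₐ k (differentialIdeal d U)

/-- The operator induced by `d` on the quotient by the differential ideal generated by `U`. -/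
def quotientDerivation (d : R →ₗ[k] R) (U : Set R) :
    DiffQuotient d U →ₗ[k] DiffQuotient d U where
  toFun := Quotient.map' d (by
    intro x y h
    rw [Submodule.quotientRel_def] at h ⊢
    rw [← map_sub]
    exact map_mem_differentialIdeal d U h)
  map_add' := by
    rintro ⟨x⟩ ⟨y⟩
    exact congrArg (Ideal.Quotient.mk (differentialIdeal d U)) (map_add d x y)
  map_smul' := by
    rintro c ⟨x⟩
    exact congrArg (Ideal.Quotient.mk (differentialIdeal d U)) (map_smul d c x)

theorem quotientDerivation_toDiffQuotient (d : R →ₗ[k] R) (U : Set R) (x : R) :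
    quotientDerivation d U (toDiffQuotient d U x) = toDiffQuotient d U (d x) := rfl

/-- The family `b` is a `k`-basis of the vector space `V`. -/
def IsBasisFamily (k : Type*) [Field k] {ι V : Type*} [AddCommGroup V] [Module k V] (b : ι → V) :
    Prop :=
  LinearIndependent k b ∧ Submodule.span k (Set.range b) = ⊤

/-- `w` is the greatest element of the finite set `s` with respect to the strict order `r`. -/
def IsGreatestIn {M : Type*} (r : M → M → Prop) (s : Finset M) (w : M) : Prop :=
  w ∈ s ∧ ∀ v ∈ s, v ≠ w → r v w

end Differential

/-- The alphabet `Δ(X)`: the letter `x^(m)` is the pair `(m, x)`, and the letters are ordered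
lexicographically, the order of derivation `m` being compared first. -/
abbrev Letter (X : Type*) := ℕ ×ₗ X

/-- The letter `x^(m)`. -/
def letter {X : Type*} (x : X) (m : ℕ) : Letter X := toLex (m, x)

/-- The letter `x^(m+1)` for the letter `x^(m)`. -/
def Letter.succ {X : Type*} (a : Letter X) : Letter X := letter (ofLex a).2 ((ofLex a).1 + 1)

/-! ## The noncommutative case -/

namespace NC

/-- Words in the letters `Δ(X)`. -/
abbrev Word (X : Type*) := FreeMonoid (Letter X)

/-- The noncommutative polynomial algebra `k⟨Δ(X)⟩`, with basis the words. -/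
abbrev Poly (k X : Type*) [Field k] := MonoidAlgebra k (Word X)

variable {k X : Type*} [Field k]

/-- A word as a polynomial. -/
noncomputable def ofWord (w : Word X) : Poly k X := MonoidAlgebra.of k (Word X) w

/-- The polynomial `x^(m)`. -/
noncomputable def var (k : Type*) [Field k] (x : X) (m : ℕ) : Poly k X :=
  ofWord (FreeMonoid.of (letter x m))

/-- The derivative of a word, given as a list of letters:
`d 1 = 0` and `d (a w) = d(a) w + a d(w) + lam d(a) d(w)`, where `d(x^(m)) = x^(m+1)`. -/
noncomputable def derivWord (lam : k) : List (Letter X) → Poly k X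
  | [] => 0
  | a :: w =>
      ofWord (FreeMonoid.of a.succ) * ofWord (FreeMonoid.ofList w)
        + ofWord (FreeMonoid.of a) * derivWord lam w
        + lam • (ofWord (FreeMonoid.of a.succ) * derivWord lam w)

/-- The derivation `d_X` of weight `lam` on `k⟨Δ(X)⟩`: the linear extension of `derivWord`. -/
noncomputable def deriv (lam : k) : Poly k X →ₗ[k] Poly k X :=
  (Finsupp.linearCombination k fun w : Word X => derivWord lam w.toList) ∘ₗ
    (MonoidAlgebra.coeffLinearEquiv k).toLinearMap

variable [LinearOrder X]

/-- The deg-lex order on words: a longer word is greater, and words of the same length are compared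
lexicographically from the left. -/
def lt (u v : Word X) : Prop := List.Shortlex (· < ·) u.toList v.toList

/-- `w` is the leading word of `f` (for `f = 0` there is none). -/
def IsLeadingWord (f : Poly k X) (w : Word X) : Prop := IsGreatestIn lt f.coeff.support w

def IsMonic (f : Poly k X) : Prop := ∃ w, IsLeadingWord f w ∧ f.coeff w = 1

/-- `h` is trivial modulo `(S, w)`: it is a linear combination of elements
`a d^j(s) b` with `s ∈ S` and `a`, `b` words, whose leading words are smaller than `w`. -/
def TrivialMod (lam : k) (S : Set (Poly k X)) (w : Word X) (h : Poly k X) : Prop :=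
  h ∈ Submodule.span k {p : Poly k X | ∃ s ∈ S, ∃ (j : ℕ) (l a b : Word X),
    IsLeadingWord ((deriv lam ^ j) s) l ∧ lt (a * l * b) w ∧
      p = ofWord a * (deriv lam ^ j) s * ofWord b}

/-- `S` is a (differential) Gröbner-Shirshov basis in `k⟨Δ(X)⟩`: a set of monic polynomials all of
whose intersection compositions and inclusion compositions are trivial. -/
structure IsGroebnerShirshovBasis (lam : k) (S : Set (Poly k X)) : Prop where
  monic : ∀ f ∈ S, IsMonic f
  intersection : ∀ f ∈ S, ∀ g ∈ S, ∀ (i j : ℕ) (f₀ g₀ p q u v w : Word X),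
    IsLeadingWord f f₀ → IsLeadingWord g g₀ →
    IsLeadingWord ((deriv lam ^ i) f) p → IsLeadingWord ((deriv lam ^ j) g) q →
    w = p * u → w = v * q → w.length < f₀.length + g₀.length →
    TrivialMod lam S w
      ((((deriv lam ^ i) f).coeff p)⁻¹ • (deriv lam ^ i) f * ofWord u
        - ofWord v * (((deriv lam ^ j) g).coeff q)⁻¹ • (deriv lam ^ j) g)
  inclusion : ∀ f ∈ S, ∀ g ∈ S, ∀ (i j : ℕ) (p q a b w : Word X),
    IsLeadingWord ((deriv lam ^ i) f) p → IsLeadingWord ((deriv lam ^ j) g) q →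
    w = p → w = a * q * b →
    TrivialMod lam S w
      ((((deriv lam ^ i) f).coeff p)⁻¹ • (deriv lam ^ i) f
        - ofWord a * (((deriv lam ^ j) g).coeff q)⁻¹ • (deriv lam ^ j) g * ofWord b)

/-- The differential `S`-irreducible words. -/
def DIrr (lam : k) (S : Set (Poly k X)) : Set (Word X) :=
  {w | ¬ ∃ s ∈ S, ∃ (j : ℕ) (l a b : Word X),
    IsLeadingWord ((deriv lam ^ j) s) l ∧ w = a * l * b}

/-- `v` is a subword (a block of consecutive letters) of `w`. -/
def IsSubword (v w : Word X) : Prop := ∃ a b : Word X, w = a * v * b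

/-- The set `{(x^(0))^n - 1}` in the variable `x = ()`. -/
noncomputable def cyclicSet (k : Type*) [Field k] (n : ℕ) : Set (Poly k Unit) :=
  {var k () 0 ^ n - 1}

/-- The derivation of `k⟨Δ(X)⟩` for the one-element set `X = {x}`, `x = ()`. -/
noncomputable abbrev deriv₁ (lam : k) : Poly k Unit →ₗ[k] Poly k Unit := deriv (X := Unit) lam

/-- The quotient of `k⟨Δ(X)⟩` by the differential ideal generated by `(x^(0))^n - 1`. -/
abbrev CyclicQuotient (lam : k) (n : ℕ) : Type _ := DiffQuotient (deriv₁ lam) (cyclicSet k n)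

/-- The class of a polynomial in `CyclicQuotient`. -/
noncomputable def toQuotient (lam : k) (n : ℕ) : Poly k Unit →ₐ[k] CyclicQuotient lam n :=
  toDiffQuotient (deriv₁ lam) (cyclicSet k n)

/-- The derivation of `CyclicQuotient` induced by `d_X`. -/
noncomputable def cyclicDeriv (lam : k) (n : ℕ) :
    CyclicQuotient lam n →ₗ[k] CyclicQuotient lam n :=
  quotientDerivation (deriv₁ lam) (cyclicSet k n)

end NC

/-! ## The commutative case -/

namespace Comm

/-- Commutative words in the letters `Δ(X)`, written as exponent vectors. -/
abbrev Word (X : Type*) := Letter X →₀ ℕ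

/-- The polynomial algebra `k[Δ(X)]`. -/
abbrev Poly (k X : Type*) [Field k] := MvPolynomial (Letter X) k

variable {k X : Type*} [Field k]

/-- A commutative word as a polynomial. -/
noncomputable def ofWord (w : Word X) : Poly k X := MvPolynomial.monomial w 1

/-- The polynomial `x^(m)`. -/
noncomputable def var (k : Type*) [Field k] (x : X) (m : ℕ) : Poly k X :=
  MvPolynomial.X (letter x m)

/-- From `(w, d w)` to `(a w, d (a w))` for a letter `a`, by
`d (a w) = d(a) w + a d(w) + lam d(a) d(w)`, where `d(x^(m)) = x^(m+1)`. -/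
noncomputable def derivStep (lam : k) (a : Letter X) (p : Poly k X × Poly k X) :
    Poly k X × Poly k X :=
  (MvPolynomial.X a * p.1,
    MvPolynomial.X a.succ * p.1 + MvPolynomial.X a * p.2 + lam • (MvPolynomial.X a.succ * p.2))

instance derivStep_leftCommutative (lam : k) :
    LeftCommutative (derivStep (X := X) lam) := by
  constructor
  intro a b p
  simp only [derivStep, MvPolynomial.smul_eq_C_mul]
  refine Prod.ext ?_ ?_ <;> ring

/-- The derivative of a commutative word, given as a multiset of letters, by recursion on the
letters from `d 1 = 0`. -/
noncomputable def derivWord (lam : k) (w : Multiset (Letter X)) : Poly k X :=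
  (w.foldr (derivStep lam) (1, 0)).2

/-- The derivation `d_X` of weight `lam` on `k[Δ(X)]`: the linear extension of `derivWord`. -/
noncomputable def deriv (lam : k) : Poly k X →ₗ[k] Poly k X :=
  (MvPolynomial.basisMonomials (Letter X) k).constr k fun w => derivWord lam (Finsupp.toMultiset w)

variable [LinearOrder X]

/-- The letters of a commutative word, with multiplicity, in descending order. -/
noncomputable def letters (w : Word X) : List (Letter X) :=
  (Finsupp.toMultiset w).sort (fun a b => b ≤ a)

/-- The monomial order: a word of greater degree is greater, and words of the same degree are
compared lexicographically after their letters have been written in descending order. -/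
def lt (u v : Word X) : Prop := List.Shortlex (· < ·) (letters u) (letters v)

/-- `w` is the leading word of `f` (for `f = 0` there is none). -/
def IsLeadingWord (f : Poly k X) (w : Word X) : Prop := IsGreatestIn lt f.support w

def IsMonic (f : Poly k X) : Prop := ∃ w, IsLeadingWord f w ∧ f.coeff w = 1

/-- `h` is trivial modulo `(S, w)`: it is a linear combination of elements
`d^j(s) u` with `s ∈ S` and `u` a word, whose leading words are smaller than `w`. -/
def TrivialMod (lam : k) (S : Set (Poly k X)) (w : Word X) (h : Poly k X) : Prop :=
  h ∈ Submodule.span k {p : Poly k X | ∃ s ∈ S, ∃ (j : ℕ) (l u : Word X),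
    IsLeadingWord ((deriv lam ^ j) s) l ∧ lt (l + u) w ∧ p = (deriv lam ^ j) s * ofWord u}

/-- `S` is a (differential) Gröbner-Shirshov basis in `k[Δ(X)]`: a set of monic polynomials all of
whose compositions are trivial. -/
structure IsGroebnerShirshovBasis (lam : k) (S : Set (Poly k X)) : Prop where
  monic : ∀ f ∈ S, IsMonic f
  composition : ∀ f ∈ S, ∀ g ∈ S, ∀ (i j : ℕ) (f₀ g₀ p q u v w : Word X),
    IsLeadingWord f f₀ → IsLeadingWord g g₀ →
    IsLeadingWord ((deriv lam ^ i) f) p → IsLeadingWord ((deriv lam ^ j) g) q →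
    w = p + u → w = q + v → w.degree < f₀.degree + g₀.degree →
    TrivialMod lam S w
      ((((deriv lam ^ i) f).coeff p)⁻¹ • (deriv lam ^ i) f * ofWord u
        - (((deriv lam ^ j) g).coeff q)⁻¹ • (deriv lam ^ j) g * ofWord v)

/-- The differential `S`-irreducible words. -/
def DIrr (lam : k) (S : Set (Poly k X)) : Set (Word X) :=
  {w | ¬ ∃ s ∈ S, ∃ (j : ℕ) (l u : Word X),
    IsLeadingWord ((deriv lam ^ j) s) l ∧ w = l + u}

/-- The set `{(x^(0))^n - 1}` in the variable `x = ()`. -/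
noncomputable def cyclicSet (k : Type*) [Field k] (n : ℕ) : Set (Poly k Unit) :=
  {var k () 0 ^ n - 1}

/-- The derivation of `k[Δ(X)]` for the one-element set `X = {x}`, `x = ()`. -/
noncomputable abbrev deriv₁ (lam : k) : Poly k Unit →ₗ[k] Poly k Unit := deriv (X := Unit) lam

/-- The quotient of `k[Δ(X)]` by the differential ideal generated by `(x^(0))^n - 1`. -/
abbrev CyclicQuotient (lam : k) (n : ℕ) : Type _ := DiffQuotient (deriv₁ lam) (cyclicSet k n)

/-- The class of a polynomial in `CyclicQuotient`. -/
noncomputable def toQuotient (lam : k) (n : ℕ) : Poly k Unit →ₐ[k] CyclicQuotient lam n :=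
  toDiffQuotient (deriv₁ lam) (cyclicSet k n)

/-- The derivation of `CyclicQuotient` induced by `d_X`. -/
noncomputable def cyclicDeriv (lam : k) (n : ℕ) :
    CyclicQuotient lam n →ₗ[k] CyclicQuotient lam n :=
  quotientDerivation (deriv₁ lam) (cyclicSet k n)

end Comm

end DiffGS

open DiffGS

universe u v w z

/-! Let f = x^n - 1, and for m ≥ 0 put e = m if `lam ≠ 0` and e = 0 if `lam = 0` (`tailIndex`). The
iterated Leibniz rule expands d^m(ab) into products d^s(a) d^t(b) with s, t ≤ m, and s + t = m in
weight 0. For powers of x the pair (m, e) gives the greatest word, and its coefficient lam^e is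
nonzero in every weight because 0^0 = 1 (`IsWeightedDerivation.pow_mul`). Splitting off one factor x
at a time shows that d^m(f) has leading word x^(m) (x^(e))^(n-1) and leading coefficient
lam^(e(n-1)), which determines the irreducible words.

Suppose the leading words of d^m(f) and d^j(f) overlap with shift r, where 1 ≤ r < n. All letters of
the first word after its initial one are x^(e), so j = e. The composition is then trivial because f
x^r = x^r f: applying d^m to this identity, the dominant terms of the two sides are multiples of
d^m(f) (x^(e))^r and x^(m) (x^(e))^(r-1) d^e(f), and all the rest consists of multiples of relations
with smaller leading words (`NC.composition_mem_below`). Disjoint leading words are handled by the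
usual exchange argument. Hence any two multiples of relations with the same leading word agree
modulo smaller ones (`NC.relationWord_sub_mem_below`). This contains the Gröbner–Shirshov property,
and it is the hypothesis of a purely linear composition-diamond lemma (`exists_lead_of_mem_span`,
`isBasisFamily_of_confluent`) which yields the basis.

In the commutative case with `lam ≠ 0`, the noncommutative expansion is projected to k[Δ(x)]. The
leading words become (x^(m))^n, which are pairwise coprime, so the exchange argument alone suffices.
In weight 0 the words x^(m) (x^(0))^(n-1) share letters and that argument does not apply.

Freeness is formal: a homomorphism from the group algebra is an element a with a^n = 1, a
differential homomorphism from the polynomial algebra is an arbitrary element a, and one that kills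
f kills the differential ideal of f. -/

namespace DiffGS

/-! ### Linear algebra of the composition-diamond lemma -/

section Triangular

variable {k V W T : Type*} [Field k] [AddCommGroup V] [Module k V]

/-- The span of the members of the family `ρ` whose leading word is smaller than `w`. -/
def spanBelow (k : Type*) [Field k] {V W T : Type*} [AddCommGroup V] [Module k V]
    (r : W → W → Prop) (lead : T → W) (ρ : T → V) (w : W) : Submodule k V :=
  Submodule.span k {p | ∃ t, r (lead t) w ∧ p = ρ t}

variable {r : W → W → Prop} {lead : T → W} {ρ : T → V}

/-- A finite set has a greatest element for a strict total order. -/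
theorem exists_isGreatestIn [IsStrictTotalOrder W r] (s : Finset W) (hs : s.Nonempty) :
    ∃ w, IsGreatestIn r s w := by
  classical
  let _ := linearOrderOfSTO r
  exact ⟨s.max' hs, s.max'_mem hs, fun v hv hne => lt_of_le_of_ne (s.le_max' v hv) hne⟩

/-- If leading words can be removed, every vector is congruent to a combination of words which are
not leading words. -/
theorem span_sup_span_eq_top (hwf : WellFounded r) (b : V ≃ₗ[k] (W →₀ k))
    (h1 : ∀ t, b (ρ t) (lead t) = 1) (h2 : ∀ t v, b (ρ t) v ≠ 0 → v ≠ lead t → r v (lead t)) :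
    Submodule.span k (Set.range ρ) ⊔
      Submodule.span k ((fun w => b.symm (Finsupp.single w 1)) '' {w | ∀ t, lead t ≠ w}) = ⊤ := by
  set N := Submodule.span k (Set.range ρ) ⊔
      Submodule.span k ((fun w => b.symm (Finsupp.single w 1)) '' {w | ∀ t, lead t ≠ w})
  -- Well-founded induction: a leading word is `ρ t` minus the tail of `ρ t`, and the tail involves
  -- only smaller words.
  have key : ∀ w, b.symm (Finsupp.single w 1) ∈ N := by
    intro w
    induction w using hwf.induction with
    | _ w ih =>
      by_cases hw : ∃ t, lead t = w
      · obtain ⟨t, rfl⟩ := hw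
        have hρ : ρ t ∈ N := Submodule.mem_sup_left (Submodule.subset_span ⟨t, rfl⟩)
        have hrest : b.symm ((b (ρ t)).erase (lead t)) ∈ N := by
          rw [← Finsupp.sum_single ((b (ρ t)).erase (lead t)), Finsupp.sum, map_sum]
          refine Submodule.sum_mem _ fun v hv => ?_
          have hne : v ≠ lead t := by
            rintro rfl
            exact Finsupp.mem_support_iff.1 hv Finsupp.erase_same
          rw [Finsupp.mem_support_iff, Finsupp.erase_ne hne] at hv
          rw [← mul_one ((b (ρ t)).erase (lead t) v), ← smul_eq_mul, ← Finsupp.smul_single,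
            map_smul]
          exact N.smul_mem _ (ih v (h2 t v hv hne))
        have : b.symm (Finsupp.single (lead t) 1) = ρ t - b.symm ((b (ρ t)).erase (lead t)) := by
          apply b.injective
          rw [map_sub, LinearEquiv.apply_symm_apply, LinearEquiv.apply_symm_apply, ← h1 t,
            eq_sub_iff_add_eq, Finsupp.single_add_erase]
        rw [this]
        exact N.sub_mem hρ hrest
      · push Not at hw
        exact Submodule.mem_sup_right (Submodule.subset_span ⟨w, hw, rfl⟩)
  rw [eq_top_iff]
  intro x _
  rw [← b.symm_apply_apply x, ← Finsupp.sum_single (b x), Finsupp.sum, map_sum]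
  refine Submodule.sum_mem _ fun v _ => ?_
  rw [← mul_one (b x v), ← smul_eq_mul, ← Finsupp.smul_single, map_smul]
  exact N.smul_mem _ (key v)

/-- The composition-diamond lemma for linear families: if the difference of two members with the
same leading word is a combination of members with smaller leading words, then a nonzero
combination involves a leading word. -/
theorem exists_lead_of_mem_span [IsStrictTotalOrder W r] (hwf : WellFounded r)
    (b : V ≃ₗ[k] (W →₀ k))
    (h1 : ∀ t, b (ρ t) (lead t) = 1) (h2 : ∀ t v, b (ρ t) v ≠ 0 → v ≠ lead t → r v (lead t))
    (h3 : ∀ t t', lead t = lead t' → ρ t - ρ t' ∈ spanBelow k r lead ρ (lead t))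
    {f : V} (hf : f ∈ Submodule.span k (Set.range ρ)) (h0 : f ≠ 0) :
    ∃ t, b f (lead t) ≠ 0 := by
  classical
  -- One member is chosen for each leading word. By `h3` and induction the chosen members span
  -- everything, and their leading words are distinct.
  let σ : Set.range lead → T := fun w => w.2.choose
  have hσ : ∀ w, lead (σ w) = w := fun w => w.2.choose_spec
  have key : ∀ w t, lead t = w → ρ t ∈ Submodule.span k (Set.range fun w => ρ (σ w)) := by
    intro w
    induction w using hwf.induction with
    | _ w ih =>
      rintro t rfl
      have := h3 t (σ ⟨lead t, t, rfl⟩) (hσ ⟨lead t, t, rfl⟩).symm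
      rw [← sub_add_cancel (ρ t) (ρ (σ ⟨lead t, t, rfl⟩))]
      refine Submodule.add_mem _ ?_ (Submodule.subset_span ⟨_, rfl⟩)
      refine Submodule.span_le.2 ?_ this
      rintro p ⟨s, hs, rfl⟩
      exact ih _ hs s rfl
  have hf' : f ∈ Submodule.span k (Set.range fun w => ρ (σ w)) := by
    refine Submodule.span_le.2 ?_ hf
    rintro _ ⟨t, rfl⟩
    exact key _ t rfl
  rw [Finsupp.mem_span_range_iff_exists_finsupp] at hf'
  obtain ⟨c, rfl⟩ := hf'
  have hc : (c.support.image Subtype.val).Nonempty := by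
    rw [Finset.image_nonempty, Finsupp.support_nonempty_iff]
    rintro rfl
    simp at h0
  -- The greatest leading word that occurs in the combination cannot cancel, since the other chosen
  -- members contain only smaller words.
  obtain ⟨w, hw, hmax⟩ := exists_isGreatestIn (r := r) _ hc
  obtain ⟨w, hwc, rfl⟩ := Finset.mem_image.1 hw
  refine ⟨σ w, ?_⟩
  rw [Finsupp.sum, map_sum, Finset.sum_apply', Finset.sum_eq_single w]
  · rw [map_smul, Finsupp.smul_apply, h1, smul_eq_mul, mul_one]
    exact Finsupp.mem_support_iff.1 hwc
  · intro v hv hne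
    have hlt := hmax v (Finset.mem_image_of_mem _ hv) (fun h => hne (Subtype.ext h))
    rw [map_smul, Finsupp.smul_apply, smul_eq_mul]
    refine mul_eq_zero_of_right _ ?_
    by_contra hne'
    rw [hσ] at hne'
    have := h2 (σ v) w hne' (by rw [hσ]; exact fun h => hne (Subtype.ext h.symm))
    rw [hσ] at this
    exact asymm_of r this hlt
  · exact fun h => absurd hwc h

/-- Under the hypotheses of the composition-diamond lemma the words which are not leading words
form a basis of the quotient by the span of the family. -/
theorem isBasisFamily_of_confluent [IsStrictTotalOrder W r] (hwf : WellFounded r)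
    (b : V ≃ₗ[k] (W →₀ k))
    (h1 : ∀ t, b (ρ t) (lead t) = 1) (h2 : ∀ t v, b (ρ t) v ≠ 0 → v ≠ lead t → r v (lead t))
    (h3 : ∀ t t', lead t = lead t' → ρ t - ρ t' ∈ spanBelow k r lead ρ (lead t))
    {Q : Type*} [AddCommGroup Q] [Module k Q] (π : V →ₗ[k] Q) (hπ : Function.Surjective π)
    (hker : LinearMap.ker π = Submodule.span k (Set.range ρ)) {I : Set W}
    (hI : I = {w | ∀ t, lead t ≠ w}) :
    IsBasisFamily k fun w : I => π (b.symm (Finsupp.single (w : W) 1)) := by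
  subst hI
  constructor
  · rw [linearIndependent_iff]
    intro c hc
    have hmap : ∀ l : {w | ∀ t, lead t ≠ w} →₀ k, Finsupp.linearCombination k
        (fun w : {w | ∀ t, lead t ≠ w} => π (b.symm (Finsupp.single (w : W) 1))) l =
        π (b.symm (l.mapDomain Subtype.val)) := by
      intro l
      rw [Finsupp.linearCombination_apply, Finsupp.mapDomain, Finsupp.sum, Finsupp.sum, map_sum,
        map_sum]
      refine Finset.sum_congr rfl fun v _ => ?_
      rw [← map_smul, ← map_smul, Finsupp.smul_single, smul_eq_mul, mul_one]
    rw [hmap, ← LinearMap.mem_ker, hker] at hc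
    by_contra hne
    -- A nontrivial relation in the quotient lifts to a nonzero element of the kernel. Such an
    -- element involves a leading word, whereas this one is built from words that are not leading.
    obtain ⟨t, ht⟩ := exists_lead_of_mem_span hwf b h1 h2 h3 hc (by
      rw [Ne, LinearEquiv.map_eq_zero_iff]
      intro h
      exact hne (Finsupp.mapDomain_injective Subtype.val_injective
        (h.trans Finsupp.mapDomain_zero.symm)))
    rw [LinearEquiv.apply_symm_apply] at ht
    refine ht (Finsupp.mapDomain_of_notMem_range _ _ ?_)
    rintro ⟨⟨w, hw⟩, h⟩
    exact hw t h.symm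
  · have htop := span_sup_span_eq_top hwf b h1 h2
    rw [← hker] at htop
    have := congrArg (Submodule.map π) htop
    rw [Submodule.map_sup, Submodule.map_top, LinearMap.range_eq_top.2 hπ,
      (LinearMap.le_ker_iff_map).1 le_rfl, bot_sup_eq, Submodule.map_span, ← Set.image_comp] at this
    rw [← this, Set.image_eq_range]
    rfl

end Triangular

/-! ### Iterated Leibniz rule in weight `lam` -/

section Weighted

variable {k R : Type*} [Field k] [Ring R] [Algebra k R] {lam : k} {d : R →ₗ[k] R}

theorem pow_mem_differentialIdeal (d : R →ₗ[k] R) {U : Set R} {u : R} (hu : u ∈ U) (m : ℕ) :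
    (d ^ m) u ∈ differentialIdeal d U := by
  induction m with
  | zero =>
    simp only [differentialIdeal, Submodule.mem_sInf]
    exact fun I hI => hI.2.1 hu
  | succ m ih =>
    rw [pow_succ', Module.End.mul_apply]
    exact map_mem_differentialIdeal d U ih

theorem differentialIdeal_le (d : R →ₗ[k] R) {U : Set R} {I : Ideal R} (hI : I.IsTwoSided)
    (hU : U ⊆ I) (hd : ∀ x ∈ I, d x ∈ I) : differentialIdeal d U ≤ I :=
  sInf_le ⟨hI, hU, hd⟩

/-- The index `e` for which `d^m a d^e b` is the leading term of `d^m (a b)`. -/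
def tailIndex [DecidableEq k] (lam : k) (m : ℕ) : ℕ := if lam = 0 then 0 else m

/-- The pairs `(s, t)` for which `d^s a d^t b` occurs in `d^m (a b)`. -/
def IsLeibnizPair (lam : k) (m s t : ℕ) : Prop := s ≤ m ∧ t ≤ m ∧ (lam = 0 → s + t = m)

variable [DecidableEq k]

theorem isLeibnizPair_tailIndex (lam : k) (m : ℕ) : IsLeibnizPair lam m m (tailIndex lam m) := by
  unfold IsLeibnizPair tailIndex
  split_ifs <;> simp_all

/-- This idempotence makes the tail of a leading word again a leading word of the same shape, with
index `tailIndex lam m`, so that overlaps do not produce new kinds of words. -/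
theorem tailIndex_tailIndex (lam : k) (m : ℕ) :
    tailIndex lam (tailIndex lam m) = tailIndex lam m := by
  unfold tailIndex
  split_ifs <;> rfl

/-- For `lam = 0` the exponent is 0 and `0 ^ 0 = 1`. Leading coefficients are therefore invertible
in every weight, and both cases run uniformly. -/
theorem pow_tailIndex_mul_ne_zero (lam : k) (m r : ℕ) : lam ^ (tailIndex lam m * r) ≠ 0 := by
  unfold tailIndex
  split_ifs with h
  · simp
  · exact pow_ne_zero _ h

/-- The iterated Leibniz rule, up to the terms other than the leading one. -/
theorem IsWeightedDerivation.pow_mul (hd : IsWeightedDerivation lam d) (a b : R) (m : ℕ) :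
    (d ^ m) (a * b) - lam ^ tailIndex lam m • ((d ^ m) a * (d ^ tailIndex lam m) b) ∈
      Submodule.span k {p | ∃ s t, IsLeibnizPair lam m s t ∧ (s, t) ≠ (m, tailIndex lam m) ∧
        p = (d ^ s) a * (d ^ t) b} := by
  have hprod : ∀ s t, d ((d ^ s) a * (d ^ t) b) = (d ^ (s + 1)) a * (d ^ t) b +
      (d ^ s) a * (d ^ (t + 1)) b + lam • ((d ^ (s + 1)) a * (d ^ (t + 1)) b) := by
    intro s t
    rw [hd.leibniz]
    simp only [pow_succ', Module.End.mul_apply]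
  induction m with
  | zero => simp [tailIndex]
  | succ m ih =>
    set N := Submodule.span k {p | ∃ s t, IsLeibnizPair lam (m + 1) s t ∧
      (s, t) ≠ (m + 1, tailIndex lam (m + 1)) ∧ p = (d ^ s) a * (d ^ t) b} with hN
    have hmem : ∀ s t, IsLeibnizPair lam (m + 1) s t →
        (s, t) ≠ (m + 1, tailIndex lam (m + 1)) → (d ^ s) a * (d ^ t) b ∈ N :=
      fun s t h h' => Submodule.subset_span ⟨s, t, h, h', rfl⟩
    -- Differentiation raises `s`, `t` or both by one. The new leading pair can arise only from the
    -- old one, so the remainder for `m` stays a remainder for `m + 1`.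
    have hrest := Submodule.mem_map_of_mem (f := d) ih
    have hle : (Submodule.span k {p | ∃ s t, IsLeibnizPair lam m s t ∧
        (s, t) ≠ (m, tailIndex lam m) ∧ p = (d ^ s) a * (d ^ t) b}).map d ≤ N := by
      rw [Submodule.map_span, Submodule.span_le]
      rintro _ ⟨_, ⟨s, t, ⟨hs, ht, h0⟩, hne, rfl⟩, rfl⟩
      rw [hprod]
      unfold tailIndex at hne hmem
      unfold IsLeibnizPair at hmem
      by_cases hl : lam = 0
      · subst hl
        simp only [if_true, true_implies, Ne, Prod.mk.injEq, not_and] at *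
        rw [zero_smul, add_zero]
        exact N.add_mem (hmem _ _ (by omega) (by omega)) (hmem _ _ (by omega) (by omega))
      · simp only [hl, if_false, false_implies, and_true, Ne, Prod.mk.injEq, not_and] at *
        exact N.add_mem (N.add_mem (hmem _ _ (by omega) (by omega))
          (hmem _ _ (by omega) (by omega))) (N.smul_mem _ (hmem _ _ (by omega) (by omega)))
    have hrest := hle hrest
    rw [map_sub, map_smul, hprod, ← Module.End.mul_apply, ← pow_succ'] at hrest
    unfold tailIndex at *
    unfold IsLeibnizPair at hmem
    -- Besides the new leading term, the derivative of the old one contributes the pair `(m, 1)` in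
    -- weight 0, and `(m + 1, m)` and `(m, m + 1)` otherwise.
    by_cases hl : lam = 0
    · subst hl
      simp only [if_true, true_implies, Ne, Prod.mk.injEq, not_and, pow_zero, one_smul,
        zero_smul, add_zero] at *
      have h1 := hmem m 1 (by omega) (by omega)
      convert N.add_mem hrest h1 using 1
      simp only [zero_add, pow_one]
      abel
    · simp only [hl, if_false, false_implies, and_true, Ne, Prod.mk.injEq, not_and] at *
      have h1 := hmem (m + 1) m (by omega) (by omega)
      have h2 := hmem m (m + 1) (by omega) (by omega)
      convert N.add_mem hrest (N.smul_mem (lam ^ m) (N.add_mem h1 h2)) using 1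
      rw [pow_succ lam, mul_smul]
      simp only [smul_add]
      abel

theorem IsWeightedDerivation.pow_mul_mem (hd : IsWeightedDerivation lam d) (a b : R) (m : ℕ) :
    (d ^ m) (a * b) ∈ Submodule.span k {p | ∃ s t, IsLeibnizPair lam m s t ∧
        p = (d ^ s) a * (d ^ t) b} := by
  rw [← sub_add_cancel ((d ^ m) (a * b))
    (lam ^ tailIndex lam m • ((d ^ m) a * (d ^ tailIndex lam m) b))]
  refine Submodule.add_mem _ (Submodule.span_mono ?_ (hd.pow_mul a b m))
    (Submodule.smul_mem _ _ (Submodule.subset_span ⟨_, _, isLeibnizPair_tailIndex lam m, rfl⟩))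
  rintro p ⟨s, t, h, -, rfl⟩
  exact ⟨s, t, h, rfl⟩

end Weighted

/-! ### Differential ideals and their quotients -/

section DifferentialIdeal

variable {k R : Type*} [Field k] [Ring R] [Algebra k R] {lam : k} {d : R →ₗ[k] R}

/-- The differential ideal generated by `U` consists of the combinations of the `a d^m(u) b`. -/
theorem IsWeightedDerivation.restrictScalars_differentialIdeal (hd : IsWeightedDerivation lam d)
    (U : Set R) : (differentialIdeal d U).restrictScalars k =
      Submodule.span k {p | ∃ u ∈ U, ∃ (m : ℕ) (a b : R), p = a * (d ^ m) u * b} := by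
  set N := Submodule.span k {p | ∃ u ∈ U, ∃ (m : ℕ) (a b : R), p = a * (d ^ m) u * b} with hN
  have hmem : ∀ u ∈ U, ∀ (m : ℕ) (a b : R), a * (d ^ m) u * b ∈ N :=
    fun u hu m a b => Submodule.subset_span ⟨u, hu, m, a, b, rfl⟩
  have hleft : ∀ c : R, ∀ x ∈ N, c * x ∈ N := by
    intro c x hx
    have : N ≤ N.comap (LinearMap.mulLeft k c) := by
      refine Submodule.span_le.2 ?_
      rintro _ ⟨u, hu, m, a, b, rfl⟩
      simpa [mul_assoc] using hmem u hu m (c * a) b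
    exact this hx
  have hright : ∀ c : R, ∀ x ∈ N, x * c ∈ N := by
    intro c x hx
    have : N ≤ N.comap (LinearMap.mulRight k c) := by
      refine Submodule.span_le.2 ?_
      rintro _ ⟨u, hu, m, a, b, rfl⟩
      simpa [mul_assoc] using hmem u hu m a (b * c)
    exact this hx
  have hder : ∀ x ∈ N, d x ∈ N := by
    intro x hx
    have : N ≤ N.comap d := by
      refine Submodule.span_le.2 ?_
      rintro _ ⟨u, hu, m, a, b, rfl⟩
      -- Each term of the Leibniz rule still contains a factor `(d ^ m) u` or `(d ^ (m + 1)) u`, so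
      -- the span is stable under `d`.
      have h1 : d (a * (d ^ m) u) = d a * (d ^ m) u + a * (d ^ (m + 1)) u +
          lam • (d a * (d ^ (m + 1)) u) := by
        rw [hd.leibniz, pow_succ', Module.End.mul_apply]
      have h2 : ∀ c, d (a * (d ^ m) u) * c ∈ N := by
        intro c
        rw [h1, add_mul, add_mul, smul_mul_assoc]
        exact N.add_mem (N.add_mem (hmem _ hu _ _ _) (hmem _ hu _ _ _))
          (N.smul_mem _ (hmem _ hu _ _ _))
      rw [SetLike.mem_coe, Submodule.mem_comap, hd.leibniz]
      exact N.add_mem (N.add_mem (h2 _) (hmem _ hu _ _ _)) (N.smul_mem _ (h2 _))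
    exact this hx
  apply le_antisymm
  · let I : Ideal R := { N with smul_mem' := fun c x hx => hleft c x hx }
    have : differentialIdeal d U ≤ I := by
      refine differentialIdeal_le d ⟨fun {a} b ha => hright b a ha⟩ ?_ hder
      intro u hu
      have : u ∈ N := by simpa using hmem u hu 0 1 1
      exact this
    exact this
  · refine Submodule.span_le.2 ?_
    rintro _ ⟨u, hu, m, a, b, rfl⟩
    exact Ideal.mul_mem_right _ _ (Ideal.mul_mem_left _ _ (pow_mem_differentialIdeal d hu m))

/-- Stability under `d` costs only the iterated derivatives of the generators, by the preceding
description as a span. -/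
theorem IsWeightedDerivation.differentialIdeal_eq_asIdeal_span (hd : IsWeightedDerivation lam d)
    (U : Set R) : differentialIdeal d U =
      (TwoSidedIdeal.span {p | ∃ u ∈ U, ∃ m : ℕ, p = (d ^ m) u}).asIdeal := by
  apply le_antisymm
  · have : (differentialIdeal d U).restrictScalars k ≤ (TwoSidedIdeal.asIdeal
        (TwoSidedIdeal.span {p | ∃ u ∈ U, ∃ m : ℕ, p = (d ^ m) u})).restrictScalars k := by
      rw [hd.restrictScalars_differentialIdeal, Submodule.span_le]
      rintro _ ⟨u, hu, m, a, b, rfl⟩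
      exact TwoSidedIdeal.mul_mem_right _ _ _ (TwoSidedIdeal.mul_mem_left _ _ _
        (TwoSidedIdeal.subset_span
          (s := {p | ∃ u ∈ U, ∃ m : ℕ, p = (d ^ m) u}) ⟨u, hu, m, rfl⟩))
    exact this
  · have : TwoSidedIdeal.span {p | ∃ u ∈ U, ∃ m : ℕ, p = (d ^ m) u} ≤
        (differentialIdeal d U).toTwoSided := by
      rw [TwoSidedIdeal.span_le]
      rintro _ ⟨u, hu, m, rfl⟩
      exact Ideal.mem_toTwoSided.2 (pow_mem_differentialIdeal d hu m)
    intro x hx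
    exact Ideal.mem_toTwoSided.1 (this hx)

theorem IsWeightedDerivation.quotientDerivation (hd : IsWeightedDerivation lam d) (U : Set R) :
    IsWeightedDerivation lam (DiffGS.quotientDerivation d U) where
  leibniz := by
    intro x y
    obtain ⟨x, rfl⟩ := Ideal.Quotient.mk_surjective x
    obtain ⟨y, rfl⟩ := Ideal.Quotient.mk_surjective y
    exact congrArg (toDiffQuotient d U) (hd.leibniz x y)
  map_one := (congrArg (toDiffQuotient d U) hd.map_one).trans (map_zero _)

theorem toDiffQuotient_surjective (d : R →ₗ[k] R) (U : Set R) :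
    Function.Surjective (toDiffQuotient d U) := Ideal.Quotient.mk_surjective

theorem ker_toDiffQuotient (d : R →ₗ[k] R) (U : Set R) :
    LinearMap.ker (toDiffQuotient d U).toLinearMap = (differentialIdeal d U).restrictScalars k := by
  ext x
  exact Ideal.Quotient.eq_zero_iff_mem

/-- A homomorphism of differential algebras which kills `U` factors through the quotient by the
differential ideal generated by `U`. -/
theorem exists_lift_of_map_eq_zero {S : Type*} [Ring S] [Algebra k S] (dS : S →ₗ[k] S) (U : Set R)
    (ψ : R →ₐ[k] S) (hψ : ∀ x, ψ (d x) = dS (ψ x)) (hU : ∀ u ∈ U, ψ u = 0) :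
    ∃ χ : DiffQuotient d U →ₐ[k] S, χ.comp (toDiffQuotient d U) = ψ ∧
      ∀ x, χ (DiffGS.quotientDerivation d U x) = dS (χ x) := by
  have hle : differentialIdeal d U ≤ RingHom.ker ψ := by
    refine differentialIdeal_le d inferInstance hU ?_
    intro x hx
    rw [RingHom.mem_ker] at hx ⊢
    rw [hψ, hx, map_zero]
  let χ : DiffQuotient d U →ₐ[k] S := Ideal.Quotient.liftₐ (differentialIdeal d U) ψ hle
  have hχ : χ.comp (toDiffQuotient d U) = ψ := by
    ext x
    rfl
  refine ⟨χ, hχ, fun x => ?_⟩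
  obtain ⟨x, rfl⟩ := toDiffQuotient_surjective d U x
  rw [quotientDerivation_toDiffQuotient]
  have h : ∀ x, χ (toDiffQuotient d U x) = ψ x := fun x => DFunLike.congr_fun hχ x
  rw [h, h, hψ]

end DifferentialIdeal

/-! ### Change of universe and uniqueness of free objects -/

section Universe

universe v' a f

/-- The operator on `ULift R` given by the operator `d` on `R`. -/
def ulift {k : Type u} [Field k] {R : Type f} [Ring R] [Algebra k R] (d : R →ₗ[k] R) :
    ULift.{v} R →ₗ[k] ULift.{v} R :=
  (ULift.algEquiv (R := k) (A := R)).symm.toLinearMap ∘ₗ d ∘ₗ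
    (ULift.algEquiv (R := k) (A := R)).toLinearMap

theorem IsWeightedDerivation.ulift {k : Type u} [Field k] {R : Type f} [Ring R] [Algebra k R]
    {lam : k} {d : R →ₗ[k] R} (hd : IsWeightedDerivation lam d) :
    IsWeightedDerivation lam (DiffGS.ulift.{u, v} d) where
  leibniz := fun x y => congrArg ULift.up (hd.leibniz x.down y.down)
  map_one := congrArg ULift.up hd.map_one

variable {k : Type u} [Field k] {A : Type a} [Ring A] [Algebra k A] {lam : k}

/-- `ULift R` is an isomorphic copy of the differential algebra `R` in a larger universe. Existence
and uniqueness are transported along `ULift.algEquiv`. -/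
theorem existsUnique_of_ulift {F : Type f} [Ring F] [Algebra k F] {dF : F →ₗ[k] F}
    {i : A →ₐ[k] F} {R : Type v} [Ring R] [Algebra k R] {d : R →ₗ[k] R} {φ : A →ₐ[k] R}
    (h : ∃! ψ : F →ₐ[k] ULift.{v'} R, (∀ x, ψ (dF x) = ulift.{u, v'} d (ψ x)) ∧
      ψ.comp i = (ULift.algEquiv (R := k) (A := R)).symm.toAlgHom.comp φ) :
    ∃! ψ : F →ₐ[k] R, (∀ x, ψ (dF x) = d (ψ x)) ∧ ψ.comp i = φ := by
  obtain ⟨ψ, ⟨h1, h2⟩, huniq⟩ := h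
  refine ⟨(ULift.algEquiv (R := k) (A := R)).toAlgHom.comp ψ, ⟨fun x => ?_, ?_⟩, ?_⟩
  · exact congrArg ULift.down (h1 x)
  · rw [AlgHom.comp_assoc, h2]
    rfl
  · rintro χ ⟨h3, h4⟩
    rw [← huniq ((ULift.algEquiv (R := k) (A := R)).symm.toAlgHom.comp χ) ⟨fun x => congrArg ULift.up (h3 x), by
      rw [AlgHom.comp_assoc, h4]⟩]
    rfl

/-- The universal property in a universe implies the universal property in smaller ones. -/
theorem IsFreeDifferentialAlgebra.lower {F : Type f} [Ring F] [Algebra k F] {dF : F →ₗ[k] F}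
    {i : A →ₐ[k] F} (h : IsFreeDifferentialAlgebra.{max v v'} lam dF i) :
    IsFreeDifferentialAlgebra.{v} lam dF i where
  derivation := h.derivation
  universal := fun R _ _ _ hd _ =>
    existsUnique_of_ulift.{u, v, v'} (h.universal (ULift.{v'} R) _ hd.ulift _)

theorem IsFreeCommDifferentialAlgebra.lower {F : Type f} [CommRing F] [Algebra k F]
    {dF : F →ₗ[k] F} {i : A →ₐ[k] F} (h : IsFreeCommDifferentialAlgebra.{max v v'} lam dF i) :
    IsFreeCommDifferentialAlgebra.{v} lam dF i where
  derivation := h.derivation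
  universal := fun R _ _ _ hd _ =>
    existsUnique_of_ulift.{u, v, v'} (h.universal (ULift.{v'} R) _ hd.ulift _)

/-- Mutually induced homomorphisms which are unique are isomorphisms. -/
theorem exists_algEquiv_of_universal {F : Type f} [Ring F] [Algebra k F] {dF : F →ₗ[k] F}
    {i : A →ₐ[k] F} {E : Type z} [Ring E] [Algebra k E] {dE : E →ₗ[k] E} {j : A →ₐ[k] E}
    (hFF : ∃! ψ : F →ₐ[k] F, (∀ x, ψ (dF x) = dF (ψ x)) ∧ ψ.comp i = i)
    (hFE : ∃! ψ : F →ₐ[k] E, (∀ x, ψ (dF x) = dE (ψ x)) ∧ ψ.comp i = j)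
    (hEF : ∃! ψ : E →ₐ[k] F, (∀ x, ψ (dE x) = dF (ψ x)) ∧ ψ.comp j = i)
    (hEE : ∃! ψ : E →ₐ[k] E, (∀ x, ψ (dE x) = dE (ψ x)) ∧ ψ.comp j = j) :
    ∃ e : F ≃ₐ[k] E, (∀ x, e (dF x) = dE (e x)) ∧ ∀ x, e (i x) = j x := by
  obtain ⟨f, ⟨f1, f2⟩, -⟩ := hFE
  obtain ⟨g, ⟨g1, g2⟩, -⟩ := hEF
  refine ⟨AlgEquiv.ofAlgHom f g ?_ ?_, f1, fun x => DFunLike.congr_fun f2 x⟩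
  · refine hEE.unique ⟨fun x => ?_, ?_⟩ ⟨fun x => rfl, rfl⟩
    · simp [f1, g1]
    · rw [AlgHom.comp_assoc, g2, f2]
  · refine hFF.unique ⟨fun x => ?_, ?_⟩ ⟨fun x => rfl, rfl⟩
    · simp [f1, g1]
    · rw [AlgHom.comp_assoc, f2, g2]

end Universe

/-! ### Homomorphisms from the group algebra of a cyclic group -/

section Cyclic

variable {k : Type*} [Field k] {G : Type*} [Group G] {g : G}

/-- Homomorphisms from the group algebra of a cyclic group are determined on a generator. -/
theorem algHom_ext_of_generator (hg : ∀ h : G, h ∈ Subgroup.zpowers g) {S : Type*} [Ring S]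
    [Algebra k S] {φ ψ : MonoidAlgebra k G →ₐ[k] S}
    (h : φ (MonoidAlgebra.of k G g) = ψ (MonoidAlgebra.of k G g)) : φ = ψ := by
  refine MonoidAlgebra.algHom_ext' ?_ (by ext)
  -- A monoid homomorphism on a group lands in the units. Group homomorphisms that agree on `g`
  -- agree on the subgroup it generates.
  have : ((φ : MonoidAlgebra k G →* S).comp (MonoidAlgebra.of k G)).toHomUnits =
      ((ψ : MonoidAlgebra k G →* S).comp (MonoidAlgebra.of k G)).toHomUnits := by
    refine MonoidHom.eq_of_eqOn_dense (s := {g}) ?_ ?_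
    · rw [← Subgroup.zpowers_eq_closure, eq_top_iff]
      exact fun x _ => hg x
    · rintro _ rfl
      exact Units.ext h
  ext x
  exact congrArg Units.val (DFunLike.congr_fun this x)

/-- An element with `a ^ n = 1` is the image of the generator of a cyclic group of order `n`. -/
theorem exists_algHom_of_pow_eq_one {n : ℕ} (hG : Nat.card G = n)
    (hg : ∀ h : G, h ∈ Subgroup.zpowers g) {S : Type*} [Ring S] [Algebra k S] {a : S} (hn : n ≠ 0)
    (ha : a ^ n = 1) :
    ∃ i : MonoidAlgebra k G →ₐ[k] S, i (MonoidAlgebra.of k G g) = a := by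
  have hord : orderOf g = n := by rw [orderOf_eq_card_of_forall_mem_zpowers hg, hG]
  have hu : Units.ofPowEqOne a n ha hn ^ n = 1 := Units.pow_ofPowEqOne ha hn
  refine ⟨MonoidAlgebra.lift k S G ((Units.coeHom S).comp (monoidHomOfForallMemZpowers hg
    (g' := Units.ofPowEqOne a n ha hn) ?_)), ?_⟩
  · rw [hord]
    exact orderOf_dvd_of_pow_eq_one hu
  · rw [MonoidAlgebra.lift_of, MonoidHom.comp_apply, monoidHomOfForallMemZpowers_apply_gen]
    rfl

theorem algHom_generator_pow {n : ℕ} (hG : Nat.card G = n) {S : Type*} [Ring S] [Algebra k S]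
    (φ : MonoidAlgebra k G →ₐ[k] S) : φ (MonoidAlgebra.of k G g) ^ n = 1 := by
  rw [← map_pow, ← map_pow, ← hG, pow_card_eq_one', map_one, map_one]

end Cyclic

/-! ### Noncommutative polynomials: derivation and deg-lex order -/

namespace NC

section General

variable {k X : Type*} [Field k]

theorem ofWord_mul (v w : Word X) : (ofWord (v * w) : Poly k X) = ofWord v * ofWord w :=
  map_mul (MonoidAlgebra.of k (Word X)) v w

theorem ofWord_one : (ofWord 1 : Poly k X) = 1 := map_one (MonoidAlgebra.of k (Word X))

theorem coeff_ofWord [DecidableEq (Word X)] (v w : Word X) :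
    (ofWord v : Poly k X).coeff w = if v = w then 1 else 0 := by
  simp [ofWord, MonoidAlgebra.of_apply, Finsupp.single_apply]

/-- The polynomials all of whose words belong to `A`. -/
theorem mem_span_ofWord {A : Set (Word X)} {p : Poly k X} :
    p ∈ Submodule.span k (ofWord '' A) ↔ ∀ w, p.coeff w ≠ 0 → w ∈ A := by
  classical
  constructor
  · intro hp
    induction hp using Submodule.span_induction with
    | mem x hx =>
      obtain ⟨v, hv, rfl⟩ := hx
      intro w hw
      rw [coeff_ofWord] at hw
      split_ifs at hw with h
      · exact h ▸ hv
      · exact absurd rfl hw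
    | zero => intro w hw; simp at hw
    | add x y _ _ hx hy =>
      intro w hw
      by_cases h : x.coeff w = 0
      · exact hy w (fun h' => hw (by simp [h, h']))
      · exact hx w h
    | smul c x _ hx =>
      intro w hw
      exact hx w (fun h' => hw (by simp [h']))
  · intro h
    rw [← MonoidAlgebra.sum_coeff_single p]
    refine Submodule.sum_mem _ fun w hw => ?_
    have : MonoidAlgebra.single w (p.coeff w) = p.coeff w • (ofWord w : Poly k X) := by
      simp [ofWord, MonoidAlgebra.of_apply, MonoidAlgebra.smul_single]
    rw [this]
    exact Submodule.smul_mem _ _ (Submodule.subset_span ⟨w, h w (Finsupp.mem_support_iff.1 hw), rfl⟩)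

/-- Membership in a subspace is linear in `q`, so it may be tested on words. This turns estimates of
leading words into statements about polynomials. -/
theorem mul_mem_of_forall_right {B : Set (Word X)} {N : Submodule k (Poly k X)} {p q : Poly k X}
    (h : ∀ w ∈ B, p * ofWord w ∈ N) (hq : q ∈ Submodule.span k (ofWord '' B)) : p * q ∈ N := by
  have : Submodule.span k (ofWord '' B) ≤ N.comap (LinearMap.mulLeft k p) := by
    rw [Submodule.span_le]
    rintro _ ⟨w, hw, rfl⟩
    exact h w hw
  exact this hq

theorem mul_mem_of_forall_left {A : Set (Word X)} {N : Submodule k (Poly k X)} {p q : Poly k X}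
    (h : ∀ v ∈ A, ofWord v * q ∈ N) (hp : p ∈ Submodule.span k (ofWord '' A)) : p * q ∈ N := by
  have : Submodule.span k (ofWord '' A) ≤ N.comap (LinearMap.mulRight k q) := by
    rw [Submodule.span_le]
    rintro _ ⟨w, hw, rfl⟩
    exact h w hw
  exact this hp

theorem span_range_ofWord : Submodule.span k (Set.range (ofWord : Word X → Poly k X)) = ⊤ := by
  rw [eq_top_iff, ← Set.image_univ]
  exact fun p _ => mem_span_ofWord.2 fun w _ => Set.mem_univ w

theorem deriv_ofWord (lam : k) (w : Word X) :
    deriv lam (ofWord w) = derivWord lam w.toList := by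
  simp [deriv, ofWord, MonoidAlgebra.of_apply]

theorem deriv_ofWord_of_mul (lam : k) (a : Letter X) (w : Word X) :
    deriv lam (ofWord (FreeMonoid.of a * w)) =
      ofWord (FreeMonoid.of a.succ) * ofWord w + ofWord (FreeMonoid.of a) * deriv lam (ofWord w) +
        lam • (ofWord (FreeMonoid.of a.succ) * deriv lam (ofWord w)) := by
  rw [deriv_ofWord, deriv_ofWord]
  rfl

theorem deriv_one (lam : k) : deriv lam (1 : Poly k X) = 0 := by
  rw [← ofWord_one, deriv_ofWord]
  rfl

theorem deriv_ofWord_of (lam : k) (a : Letter X) :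
    deriv lam (ofWord (FreeMonoid.of a)) = ofWord (FreeMonoid.of a.succ) := by
  rw [← mul_one (FreeMonoid.of a), deriv_ofWord_of_mul, ofWord_one, deriv_one]
  simp

/-- The definition has the Leibniz rule built in only for splitting off the first letter. Induction
on `v` moves the cut to an arbitrary place. -/
theorem deriv_ofWord_mul (lam : k) (v w : Word X) :
    deriv lam (ofWord v * ofWord w) = deriv lam (ofWord v) * ofWord w +
      ofWord v * deriv lam (ofWord w) + lam • (deriv lam (ofWord v) * deriv lam (ofWord w)) := by
  induction v using FreeMonoid.inductionOn' with
  | one => simp [ofWord_one, deriv_one]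
  | of_mul a v ih =>
    rw [← ofWord_mul, mul_assoc, deriv_ofWord_of_mul, deriv_ofWord_of_mul, ofWord_mul, ofWord_mul,
      ih]
    simp only [mul_add, add_mul, smul_add, mul_smul_comm, smul_mul_assoc, mul_assoc]
    abel

theorem isWeightedDerivation_deriv (lam : k) :
    IsWeightedDerivation lam (deriv lam : Poly k X →ₗ[k] Poly k X) where
  map_one := deriv_one lam
  leibniz := by
    intro p q
    have hp : p ∈ Submodule.span k (Set.range (ofWord : Word X → Poly k X)) := by
      rw [span_range_ofWord]; trivial
    have hq : q ∈ Submodule.span k (Set.range (ofWord : Word X → Poly k X)) := by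
      rw [span_range_ofWord]; trivial
    induction hp using Submodule.span_induction with
    | mem x hx =>
      obtain ⟨v, rfl⟩ := hx
      induction hq using Submodule.span_induction with
      | mem y hy =>
        obtain ⟨w, rfl⟩ := hy
        exact deriv_ofWord_mul lam v w
      | zero => simp
      | add y z _ _ hy hz =>
        simp only [mul_add, map_add, hy, hz, smul_add]
        abel
      | smul c y _ hy =>
        simp only [mul_smul_comm, map_smul, hy, smul_add, smul_comm lam c]
    | zero => simp
    | add x y _ _ hx hy =>
      simp only [add_mul, map_add, hx, hy, smul_add]
      abel
    | smul c x _ hx =>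
      simp only [smul_mul_assoc, map_smul, hx, smul_add, smul_comm lam c]

theorem pow_deriv_var (lam : k) (x : X) (m : ℕ) : (deriv lam ^ m) (var k x 0) = var k x m := by
  induction m with
  | zero => rfl
  | succ m ih =>
    rw [pow_succ', Module.End.mul_apply, ih, var, deriv_ofWord_of]
    rfl

section Order

variable [LinearOrder X]

theorem lt_iff {u v : Word X} : lt u v ↔ u.length < v.length ∨
    u.length = v.length ∧ List.Lex (· < ·) u.toList v.toList :=
  List.shortlex_def

instance isStrictTotalOrder_lt : IsStrictTotalOrder (Word X) lt where
  trichotomous := fun u v h h' =>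
    FreeMonoid.toList.injective (Std.Trichotomous.trichotomous (r := List.Shortlex (· < ·)) _ _ h h')
  irrefl := fun u h => (irrefl_of (List.Shortlex (· < ·)) u.toList) h
  trans := by
    intro u v w h h'
    rw [lt_iff] at *
    rcases h with h | ⟨h, hl⟩ <;> rcases h' with h' | ⟨h', hl'⟩
    · exact Or.inl (h.trans h')
    · exact Or.inl (h' ▸ h)
    · exact Or.inl (h ▸ h')
    · exact Or.inr ⟨h.trans h', List.lt_trans hl hl'⟩

/-- Length is compared first, so the infinite alphabet does no harm: on words of one length this is
a lexicographic product of well-orders. -/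
theorem wellFounded_lt [WellFoundedLT X] : WellFounded (lt : Word X → Word X → Prop) :=
  InvImage.wf _ (List.Shortlex.wf _root_.wellFounded_lt)

/-- Equal lengths are essential. If `s` were a proper prefix of `t`, appending `u` could reverse the
comparison. -/
theorem lex_append_right {α : Type*} {r : α → α → Prop} {s t : List α} (h : List.Lex r s t)
    (hlen : s.length = t.length) (u : List α) : List.Lex r (s ++ u) (t ++ u) := by
  induction h with
  | nil => simp at hlen
  | cons _ ih => exact List.Lex.cons (ih (by simpa using hlen))
  | rel h => exact List.Lex.rel h

theorem lt_mul_mul {u v : Word X} (h : lt u v) (a b : Word X) : lt (a * u * b) (a * v * b) := by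
  rw [lt_iff] at *
  simp only [FreeMonoid.length_mul, FreeMonoid.toList_mul]
  rcases h with h | ⟨h, hl⟩
  · left; omega
  · refine Or.inr ⟨by omega, lex_append_right (List.Lex.append_left _ hl _) ?_ _⟩
    simpa [FreeMonoid.length] using h

theorem lt_mul_left {u v : Word X} (h : lt u v) (a : Word X) : lt (a * u) (a * v) := by
  simpa using lt_mul_mul h a 1

theorem lt_mul_right {u v : Word X} (h : lt u v) (b : Word X) : lt (u * b) (v * b) := by
  simpa using lt_mul_mul h 1 b

theorem IsLeadingWord.unique {f : Poly k X} {v w : Word X} (hv : IsLeadingWord f v)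
    (hw : IsLeadingWord f w) : v = w := by
  by_contra hne
  exact asymm_of lt (hv.2 w hw.1 (Ne.symm hne)) (hw.2 v hv.1 hne)

/-- Leading terms are recorded throughout as congruences modulo the span of smaller words, a form
that is stable under sums and products. This lemma and the next two translate back to coefficients
and leading words. -/
theorem coeff_eq_of_sub_mem {f : Poly k X} {w : Word X} {c : k}
    (h : f - c • ofWord w ∈ Submodule.span k (ofWord '' {v | lt v w})) : f.coeff w = c := by
  classical
  by_contra hne
  refine irrefl_of lt w (mem_span_ofWord.1 h w ?_)
  rw [MonoidAlgebra.coeff_sub, Finsupp.sub_apply, MonoidAlgebra.coeff_smul_apply, coeff_ofWord,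
    if_pos rfl, smul_eq_mul, mul_one]
  exact sub_ne_zero.2 hne

theorem lt_of_sub_mem {f : Poly k X} {w : Word X} {c : k}
    (h : f - c • ofWord w ∈ Submodule.span k (ofWord '' {v | lt v w})) {v : Word X}
    (hv : f.coeff v ≠ 0) (hne : v ≠ w) : lt v w := by
  classical
  refine mem_span_ofWord.1 h v ?_
  rwa [MonoidAlgebra.coeff_sub, Finsupp.sub_apply, MonoidAlgebra.coeff_smul_apply, coeff_ofWord,
    if_neg hne.symm, smul_zero, sub_zero]

theorem isLeadingWord_of_sub_mem {f : Poly k X} {w : Word X} {c : k} (hc : c ≠ 0)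
    (h : f - c • ofWord w ∈ Submodule.span k (ofWord '' {v | lt v w})) : IsLeadingWord f w :=
  ⟨Finsupp.mem_support_iff.2 (by rwa [coeff_eq_of_sub_mem h]),
    fun _ hv hne => lt_of_sub_mem h (Finsupp.mem_support_iff.1 hv) hne⟩

end Order

end General

end NC

/-! ### Words that occur in d^m(x^r), and overlaps of the greatest ones -/

namespace NC

section Bounds

variable {k : Type*} [Field k] {lam : k}

/-- The words of length `r` which may occur in `d^m (x^r)`: all orders of derivation are at most
`m`, and in weight `0` they add up to `m`. -/
def IsBounded (lam : k) (m r : ℕ) (w : Word Unit) : Prop :=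
  w.length = r ∧ (∀ a ∈ w.toList, (ofLex a).1 ≤ m) ∧
    (lam = 0 → (w.toList.map fun a => (ofLex a).1).sum = m)

theorem IsBounded.mul {m r s t q : ℕ} {v w : Word Unit} (h : IsLeibnizPair lam m s t)
    (hv : IsBounded lam s r v) (hw : IsBounded lam t q w) : IsBounded lam m (r + q) (v * w) := by
  obtain ⟨hs, ht, h0⟩ := h
  refine ⟨by rw [FreeMonoid.length_mul, hv.1, hw.1], ?_, ?_⟩
  · intro a ha
    rw [FreeMonoid.toList_mul, List.mem_append] at ha
    rcases ha with ha | ha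
    · exact (hv.2.1 a ha).trans hs
    · exact (hw.2.1 a ha).trans ht
  · intro hl
    rw [FreeMonoid.toList_mul, List.map_append, List.sum_append, hv.2.2 hl, hw.2.2 hl, h0 hl]

theorem eq_letter (a : Letter Unit) : a = letter () (ofLex a).1 := rfl

theorem letter_lt_letter {i j : ℕ} (h : i < j) : letter () i < letter () j :=
  Prod.Lex.toLex_lt_toLex.2 (Or.inl h)

/-- At the first place where `l` differs from the constant word, its letter is smaller. -/
theorem lex_replicate {e : ℕ} {l : List (Letter Unit)} (h : ∀ a ∈ l, (ofLex a).1 ≤ e)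
    (hne : l ≠ List.replicate l.length (letter () e)) :
    List.Lex (· < ·) l (List.replicate l.length (letter () e)) := by
  induction l with
  | nil => simp at hne
  | cons a l ih =>
    rw [List.length_cons, List.replicate_succ] at hne ⊢
    rcases (h a List.mem_cons_self).lt_or_eq with hlt | heq
    · exact List.Lex.rel (letter_lt_letter hlt)
    · have ha : a = letter () e := by rw [eq_letter a, heq]
      subst ha
      exact List.Lex.cons (ih (fun b hb => h b (List.mem_cons_of_mem _ hb)) (by simpa using hne))

variable [DecidableEq k]

/-- The leading word of `d^m (x^r)`. -/
def topWord (lam : k) (m r : ℕ) : Word Unit :=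
  FreeMonoid.of (letter () m) * FreeMonoid.of (letter () (tailIndex lam m)) ^ (r - 1)

theorem toList_of_pow (a : Letter Unit) (r : ℕ) :
    (FreeMonoid.of a ^ r).toList = List.replicate r a := by
  induction r with
  | zero => rfl
  | succ r ih => rw [pow_succ', FreeMonoid.toList_mul, ih]; rfl

theorem toList_topWord (m r : ℕ) : (topWord lam m r).toList =
    letter () m :: List.replicate (r - 1) (letter () (tailIndex lam m)) := by
  rw [topWord, FreeMonoid.toList_mul, toList_of_pow]
  rfl

theorem length_topWord {m r : ℕ} (hr : 1 ≤ r) : (topWord lam m r).length = r := by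
  change (topWord lam m r).toList.length = r
  rw [toList_topWord, List.length_cons, List.length_replicate, Nat.sub_add_cancel hr]

theorem topWord_injective {i j r : ℕ} (h : topWord lam i r = topWord lam j r) : i = j := by
  have := congrArg FreeMonoid.toList h
  rw [toList_topWord, toList_topWord, List.cons_eq_cons] at this
  exact congrArg (fun a : Letter Unit => (ofLex a).1) this.1

theorem isBounded_topWord {m r : ℕ} (hr : 1 ≤ r) : IsBounded lam m r (topWord lam m r) := by
  refine ⟨length_topWord hr, ?_, ?_⟩
  · intro a ha
    rw [toList_topWord, List.mem_cons] at ha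
    rcases ha with rfl | ha
    · exact le_rfl
    · rw [List.eq_of_mem_replicate ha]
      exact (isLeibnizPair_tailIndex lam m).2.1
  · intro hl
    rw [toList_topWord]
    simp [tailIndex, hl, letter]

/-- Either the first letter is below x^(m), which decides the comparison, or it equals x^(m) and the
remaining letters are bounded by the constant tail. -/
theorem IsBounded.lt_topWord {m r : ℕ} {w : Word Unit} (hr : 1 ≤ r) (hw : IsBounded lam m r w)
    (hne : w ≠ topWord lam m r) : lt w (topWord lam m r) := by
  rw [lt_iff]
  refine Or.inr ⟨by rw [hw.1, length_topWord hr], ?_⟩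
  have hne' : w.toList ≠ (topWord lam m r).toList := fun h => hne (FreeMonoid.toList.injective h)
  obtain ⟨hlen, hle, hsum⟩ := hw
  change w.toList.length = r at hlen
  rw [toList_topWord] at hne' ⊢
  cases hl : w.toList with
  | nil => rw [hl] at hlen; simp at hlen; omega
  | cons a l =>
    rw [hl] at hlen hle hsum hne'
    have hlen' : r - 1 = l.length := by rw [← hlen]; simp
    rcases (hle a List.mem_cons_self).lt_or_eq with hlt | heq
    · exact List.Lex.rel (letter_lt_letter hlt)
    · have ha : a = letter () m := by rw [eq_letter a, heq]
      subst ha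
      rw [hlen'] at hne' ⊢
      refine List.Lex.cons (lex_replicate (fun b hb => ?_) (by simpa using hne'))
      -- In weight 0 the first letter already uses up the whole sum `m`, so the other letters have
      -- order 0.
      unfold tailIndex
      split_ifs with h0
      · have := hsum h0
        rw [List.map_cons, List.sum_cons] at this
        have h1 := List.single_le_sum (fun _ _ => Nat.zero_le _) _ (List.mem_map_of_mem
          (f := fun a : Letter Unit => (ofLex a).1) hb)
        simp only [letter, ofLex_toLex] at this
        omega
      · exact hle b (List.mem_cons_of_mem _ hb)

/-- Cut the top word after `r` letters: the letter x^(m) in front forces `s = m`, and the first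
letter after the cut forces `t` to be at least the tail index; then `t ≤ m`, or `s + t = m` in
weight 0, gives equality. Consequently every other term of a Leibniz expansion is strictly smaller
than the top word. -/
theorem IsBounded.eq_of_mul_eq_topWord {m r s t q : ℕ} {v w : Word Unit} (hr : 1 ≤ r) (hq : 1 ≤ q)
    (h : IsLeibnizPair lam m s t) (hv : IsBounded lam s r v) (hw : IsBounded lam t q w)
    (heq : v * w = topWord lam m (r + q)) :
    (s, t) = (m, tailIndex lam m) ∧ v = topWord lam m r ∧
      w = topWord lam (tailIndex lam m) q := by
  obtain ⟨hs, ht, h0⟩ := h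
  have heq' := congrArg FreeMonoid.toList heq
  have hvl : v.toList.length = r := hv.1
  have hwl : w.toList.length = q := hw.1
  rw [FreeMonoid.toList_mul, toList_topWord] at heq'
  have hrep : letter () m :: List.replicate (r + q - 1) (letter () (tailIndex lam m)) =
      (letter () m :: List.replicate (r - 1) (letter () (tailIndex lam m))) ++
        (letter () (tailIndex lam m) :: List.replicate (q - 1) (letter () (tailIndex lam m))) := by
    rw [← List.replicate_succ, List.cons_append, List.replicate_append_replicate]
    congr 2
    omega
  rw [hrep] at heq'
  obtain ⟨h1, h2⟩ := List.append_inj heq' (by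
    rw [hvl, List.length_cons, List.length_replicate]; omega)
  have hsm : m ≤ s := hv.2.1 (letter () m) (by rw [h1]; exact List.mem_cons_self)
  have hsm : s = m := le_antisymm hs hsm
  refine ⟨Prod.ext hsm ?_, FreeMonoid.toList.injective (by rw [h1, toList_topWord]),
    FreeMonoid.toList.injective (by rw [h2, toList_topWord, tailIndex_tailIndex])⟩
  have htm : tailIndex lam m ≤ t :=
    hw.2.1 (letter () (tailIndex lam m)) (by rw [h2]; exact List.mem_cons_self)
  change t = tailIndex lam m
  unfold tailIndex at *
  split_ifs at * with hl
  · have := h0 hl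
    omega
  · omega

theorem topWord_mul_topWord {m r q : ℕ} (hr : 1 ≤ r) (hq : 1 ≤ q) :
    topWord lam m r * topWord lam (tailIndex lam m) q = topWord lam m (r + q) := by
  rw [topWord, topWord, topWord, tailIndex_tailIndex, ← pow_succ', mul_assoc, ← pow_add]
  congr 2
  omega

/-- An overlap of two leading words of length `n` is an overlap with a power of a letter. -/
theorem eq_of_overlap {i j r n : ℕ} {u v : Word Unit} (hr : 1 ≤ r) (hrn : r < n)
    (hv : v.length = r) (h : topWord lam i n * u = v * topWord lam j n) :
    j = tailIndex lam i ∧ u = topWord lam (tailIndex lam i) r ∧ v = topWord lam i r := by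
  have h' := congrArg FreeMonoid.toList h
  rw [FreeMonoid.toList_mul, FreeMonoid.toList_mul, toList_topWord, toList_topWord] at h'
  change v.toList.length = r at hv
  obtain ⟨p, rfl⟩ := Nat.exists_eq_add_of_lt hrn
  have hrep : (letter () i :: List.replicate (r + p + 1 - 1) (letter () (tailIndex lam i))) =
      (letter () i :: List.replicate (r - 1) (letter () (tailIndex lam i))) ++
        (letter () (tailIndex lam i) :: List.replicate p (letter () (tailIndex lam i))) := by
    rw [← List.replicate_succ, List.cons_append, List.replicate_append_replicate]
    congr 2
    omega
  rw [hrep, List.append_assoc] at h'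
  obtain ⟨h1, h2⟩ := List.append_inj h' (by
    rw [hv, List.length_cons, List.length_replicate]; omega)
  rw [List.cons_append, List.cons_eq_cons] at h2
  -- Since `r ≥ 1`, the letter at which the right word begins lies in the constant tail of the left
  -- word.
  have hj : j = tailIndex lam i := (congrArg (fun a : Letter Unit => (ofLex a).1) h2.1).symm
  subst hj
  refine ⟨rfl, FreeMonoid.toList.injective ?_, FreeMonoid.toList.injective ?_⟩
  · have h3 : List.replicate (r + p + 1 - 1) (letter () (tailIndex lam (tailIndex lam i))) =
        List.replicate p (letter () (tailIndex lam i)) ++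
          List.replicate r (letter () (tailIndex lam i)) := by
      rw [List.replicate_append_replicate, tailIndex_tailIndex]
      congr 1
      omega
    rw [h3] at h2
    rw [List.append_cancel_left h2.2, toList_topWord, tailIndex_tailIndex, ← List.replicate_succ,
      Nat.sub_add_cancel hr]
  · rw [← h1, toList_topWord]

end Bounds

/-! ### Leading term of d^m(x^n - 1) -/

section Leading

variable {k : Type*} [Field k] {lam : k}

theorem isBounded_of_letter (lam : k) (s : ℕ) :
    IsBounded lam s 1 (FreeMonoid.of (letter () s)) :=
  ⟨rfl, by simp [letter], by simp [letter]⟩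

theorem pow_deriv_one (lam : k) (m : ℕ) :
    (deriv lam ^ m) (1 : Poly k Unit) = if m = 0 then 1 else 0 := by
  cases m with
  | zero => rfl
  | succ m => rw [pow_succ, Module.End.mul_apply, deriv_one, map_zero, if_neg (Nat.succ_ne_zero m)]

/-- The element `x^n - 1`. -/
noncomputable def relation (k : Type*) [Field k] (n : ℕ) : Poly k Unit := var k () 0 ^ n - 1

theorem pow_deriv_relation (lam : k) (n m : ℕ) : (deriv lam ^ m) (relation k n) =
    (deriv lam ^ m) (var k () 0 ^ n) - if m = 0 then 1 else 0 := by
  rw [relation, map_sub, pow_deriv_one]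

variable [DecidableEq k]

theorem pow_deriv_var_pow_mem (lam : k) (m r : ℕ) :
    (deriv lam ^ m) (var k () 0 ^ r) ∈ Submodule.span k (ofWord '' {w | IsBounded lam m r w}) := by
  induction r generalizing m with
  | zero =>
    rw [pow_zero, pow_deriv_one]
    split_ifs with h
    · rw [← ofWord_one]
      refine Submodule.subset_span ⟨1, ⟨rfl, ?_, ?_⟩, rfl⟩ <;> simp [h]
    · exact Submodule.zero_mem _
  | succ r ih =>
    rw [pow_succ']
    refine Submodule.span_le.2 ?_ ((isWeightedDerivation_deriv lam).pow_mul_mem _ _ m)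
    rintro _ ⟨s, t, hst, rfl⟩
    rw [pow_deriv_var]
    refine mul_mem_of_forall_right ?_ (ih t)
    intro w hw
    rw [var, ← ofWord_mul, add_comm r 1]
    exact Submodule.subset_span ⟨_, (isBounded_of_letter lam s).mul hst hw, rfl⟩

/-- Induction on `r`, splitting off one factor x. With e = `tailIndex lam m`, the dominant Leibniz
term is lam^e x^(m) d^e(x^r). Since e is its own tail index, the exponents e and e(r - 1) add up to
e r. -/
theorem pow_deriv_var_pow_sub_mem (lam : k) (m : ℕ) {r : ℕ} (hr : 1 ≤ r) :
    (deriv lam ^ m) (var k () 0 ^ r) -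
        lam ^ (tailIndex lam m * (r - 1)) • ofWord (topWord lam m r) ∈
      Submodule.span k (ofWord '' {w | IsBounded lam m r w ∧ w ≠ topWord lam m r}) := by
  induction r, hr using Nat.le_induction generalizing m with
  | base =>
    rw [pow_one, pow_deriv_var]
    simp [topWord, var]
  | succ r hr ih =>
    set N := Submodule.span k ((ofWord : Word Unit → Poly k Unit) ''
      {w | IsBounded lam m (r + 1) w ∧ w ≠ topWord lam m (r + 1)})
    have hword : ∀ s t w, IsLeibnizPair lam m s t → IsBounded lam t r w →
        ((s, t) ≠ (m, tailIndex lam m) ∨ w ≠ topWord lam (tailIndex lam m) r) →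
        var k () s * ofWord w ∈ N := by
      intro s t w hst hw hne
      rw [var, ← ofWord_mul]
      refine Submodule.subset_span ⟨_, ⟨?_, fun heq => ?_⟩, rfl⟩
      · rw [add_comm r 1]
        exact (isBounded_of_letter lam s).mul hst hw
      · rw [add_comm r 1] at heq
        have := (isBounded_of_letter lam s).eq_of_mul_eq_topWord le_rfl hr hst hw heq
        exact hne.elim (fun h => h this.1) (fun h => h this.2.2)
    have h1 := (isWeightedDerivation_deriv lam).pow_mul (var k () 0) (var k () 0 ^ r) m
    rw [← pow_succ', pow_deriv_var] at h1
    have h1 : (deriv lam ^ m) (var k () 0 ^ (r + 1)) - lam ^ tailIndex lam m •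
        (var k () m * (deriv lam ^ tailIndex lam m) (var k () 0 ^ r)) ∈ N := by
      refine Submodule.span_le.2 ?_ h1
      rintro _ ⟨s, t, hst, hne, rfl⟩
      rw [pow_deriv_var]
      exact mul_mem_of_forall_right (fun w hw => hword s t w hst hw (Or.inl hne))
        (pow_deriv_var_pow_mem lam t r)
    have h2 : var k () m * ((deriv lam ^ tailIndex lam m) (var k () 0 ^ r) -
        lam ^ (tailIndex lam (tailIndex lam m) * (r - 1)) •
          ofWord (topWord lam (tailIndex lam m) r)) ∈ N :=
      mul_mem_of_forall_right (fun w hw => hword m _ w (isLeibnizPair_tailIndex lam m) hw.1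
        (Or.inr hw.2)) (ih (tailIndex lam m))
    convert N.add_mem h1 (N.smul_mem (lam ^ tailIndex lam m) h2) using 1
    have h3 : topWord lam m (r + 1) =
        FreeMonoid.of (letter () m) * topWord lam (tailIndex lam m) r := by
      rw [add_comm r 1, ← topWord_mul_topWord le_rfl hr]
      simp [topWord]
    have h4 : tailIndex lam m * (r + 1 - 1) = tailIndex lam m + tailIndex lam m * (r - 1) := by
      obtain ⟨q, rfl⟩ := Nat.exists_eq_add_of_le hr
      rw [Nat.add_sub_cancel, Nat.add_sub_cancel_left]
      ring
    rw [mul_sub, smul_sub, tailIndex_tailIndex, mul_smul_comm, smul_smul, ← pow_add, h4, h3,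
      ofWord_mul, var]
    abel

variable {n : ℕ}

theorem pow_deriv_relation_sub_mem (lam : k) (hn : 1 ≤ n) (m : ℕ) :
    (deriv lam ^ m) (relation k n) -
        lam ^ (tailIndex lam m * (n - 1)) • ofWord (topWord lam m n) ∈
      Submodule.span k (ofWord '' {w | lt w (topWord lam m n)}) := by
  rw [pow_deriv_relation, sub_right_comm]
  refine Submodule.sub_mem _ (Submodule.span_mono (Set.image_mono ?_)
    (pow_deriv_var_pow_sub_mem lam m hn)) ?_
  · exact fun w hw => hw.1.lt_topWord hn hw.2
  -- The constant 1 is present only for `m = 0`, and the empty word is shorter than the leading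
  -- word.
  · split_ifs
    · rw [← ofWord_one]
      refine Submodule.subset_span ⟨1, lt_iff.2 (Or.inl ?_), rfl⟩
      rw [length_topWord hn]
      exact hn
    · exact Submodule.zero_mem _

/-- The element `d^m (x^n - 1)` divided by its leading coefficient. -/
noncomputable def monicRelation (lam : k) (n m : ℕ) : Poly k Unit :=
  (lam ^ (tailIndex lam m * (n - 1)))⁻¹ • (deriv lam ^ m) (relation k n)

theorem isLeadingWord_relation (lam : k) (hn : 1 ≤ n) (m : ℕ) :
    IsLeadingWord ((deriv lam ^ m) (relation k n)) (topWord lam m n) :=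
  isLeadingWord_of_sub_mem (pow_tailIndex_mul_ne_zero lam m (n - 1))
    (pow_deriv_relation_sub_mem lam hn m)

theorem coeff_relation (lam : k) (hn : 1 ≤ n) (m : ℕ) :
    ((deriv lam ^ m) (relation k n)).coeff (topWord lam m n) =
      lam ^ (tailIndex lam m * (n - 1)) :=
  coeff_eq_of_sub_mem (pow_deriv_relation_sub_mem lam hn m)

theorem monicRelation_sub_mem (lam : k) (hn : 1 ≤ n) (m : ℕ) :
    monicRelation lam n m - ofWord (topWord lam m n) ∈
      Submodule.span k (ofWord '' {w | lt w (topWord lam m n)}) := by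
  have := Submodule.smul_mem _ (lam ^ (tailIndex lam m * (n - 1)))⁻¹
    (pow_deriv_relation_sub_mem lam hn m)
  rwa [smul_sub, smul_smul, inv_mul_cancel₀ (pow_tailIndex_mul_ne_zero lam m (n - 1)),
    one_smul] at this

end Leading

end NC

/-! ### Triviality of compositions in k⟨Δ(x)⟩ -/

namespace NC

section Confluence

variable {k : Type*} [Field k] [DecidableEq k] {lam : k} {n : ℕ}

/-- The words `a · d^j(x^n - 1) · b`, `t = (a, j, b)`, with the monic form of `d^j(x^n - 1)`. -/
noncomputable def relationWord (lam : k) (n : ℕ) (t : Word Unit × ℕ × Word Unit) : Poly k Unit :=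
  ofWord t.1 * monicRelation lam n t.2.1 * ofWord t.2.2

/-- The leading word of `relationWord`. -/
def relationLead (lam : k) (n : ℕ) (t : Word Unit × ℕ × Word Unit) : Word Unit :=
  t.1 * topWord lam t.2.1 n * t.2.2

/-- The combinations of elements `a · d^j(x^n - 1) · b` with leading words smaller than `w`. -/
noncomputable def below (lam : k) (n : ℕ) (w : Word Unit) : Submodule k (Poly k Unit) :=
  spanBelow k lt (relationLead lam n) (relationWord lam n) w

theorem relationWord_mem_below {a b w : Word Unit} {j : ℕ} (h : lt (a * topWord lam j n * b) w) :
    ofWord a * monicRelation lam n j * ofWord b ∈ below lam n w :=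
  Submodule.subset_span ⟨(a, j, b), h, rfl⟩

theorem mul_mem_below {w : Word Unit} {p : Poly k Unit} (hp : p ∈ below lam n w)
    (a b : Word Unit) : ofWord a * p * ofWord b ∈ below lam n (a * w * b) := by
  have : below lam n w ≤ (below lam n (a * w * b)).comap
      (LinearMap.mulRight k (ofWord b) ∘ₗ LinearMap.mulLeft k (ofWord a)) := by
    refine Submodule.span_le.2 ?_
    rintro _ ⟨⟨c, j, e⟩, h, rfl⟩
    have := relationWord_mem_below (k := k) (lam := lam) (n := n) (a := a * c) (b := e * b)
      (w := a * w * b) (j := j) (by simpa [mul_assoc, relationLead] using lt_mul_mul h a b)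
    simpa [relationWord, ofWord_mul, mul_assoc] using this
  exact this hp

theorem pow_deriv_relation_eq_smul (lam : k) (n m : ℕ) : (deriv lam ^ m) (relation k n) =
    lam ^ (tailIndex lam m * (n - 1)) • monicRelation lam n m := by
  rw [monicRelation, smul_smul, mul_inv_cancel₀ (pow_tailIndex_mul_ne_zero lam m (n - 1)),
    one_smul]

/-- The compositions of `d^m(x^n - 1)` are trivial, by applying `d^m` to
`(x^n - 1) x^r = x^r (x^n - 1)`. -/
theorem composition_mem_below (hn : 1 ≤ n) {r : ℕ} (hr : 1 ≤ r) (m : ℕ) :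
    monicRelation lam n m * ofWord (topWord lam (tailIndex lam m) r) -
        ofWord (topWord lam m r) * monicRelation lam n (tailIndex lam m) ∈
      below lam n (topWord lam m (n + r)) := by
  set e := tailIndex lam m with he
  set N := below lam n (topWord lam m (n + r)) with hN
  have hright : ∀ s t w, IsLeibnizPair lam m s t → IsBounded lam t r w →
      ((s, t) ≠ (m, e) ∨ w ≠ topWord lam e r) → monicRelation lam n s * ofWord w ∈ N := by
    intro s t w hst hw hne
    have hb := (isBounded_topWord (lam := lam) (m := s) hn).mul hst hw
    rw [← one_mul (monicRelation lam n s), ← ofWord_one]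
    refine relationWord_mem_below ?_
    rw [one_mul]
    refine hb.lt_topWord (by omega) fun heq => ?_
    have := (isBounded_topWord (lam := lam) (m := s) hn).eq_of_mul_eq_topWord hn hr hst hw heq
    exact hne.elim (fun h => h this.1) (fun h => h this.2.2)
  have hleft : ∀ s t w, IsLeibnizPair lam m s t → IsBounded lam s r w →
      ((s, t) ≠ (m, e) ∨ w ≠ topWord lam m r) → ofWord w * monicRelation lam n t ∈ N := by
    intro s t w hst hw hne
    have hb := hw.mul hst (isBounded_topWord (lam := lam) (m := t) hn)
    rw [← mul_one (monicRelation lam n t), ← ofWord_one, ← mul_assoc]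
    refine relationWord_mem_below ?_
    rw [mul_one]
    rw [add_comm] at hb
    refine hb.lt_topWord (by omega) fun heq => ?_
    rw [add_comm] at heq
    have := hw.eq_of_mul_eq_topWord hr hn hst (isBounded_topWord (lam := lam) (m := t) hn) heq
    exact hne.elim (fun h => h this.1) (fun h => h this.2.1)
  -- The non-dominant Leibniz terms are multiples of relations whose leading words are bounded but
  -- different from the top word, hence smaller.
  have h1 : (deriv lam ^ m) (relation k n * var k () 0 ^ r) - lam ^ e •
      ((deriv lam ^ m) (relation k n) * (deriv lam ^ e) (var k () 0 ^ r)) ∈ N := by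
    refine Submodule.span_le.2 ?_ ((isWeightedDerivation_deriv lam).pow_mul _ _ m)
    rintro _ ⟨s, t, hst, hne, rfl⟩
    rw [SetLike.mem_coe, pow_deriv_relation_eq_smul, smul_mul_assoc]
    exact N.smul_mem _ (mul_mem_of_forall_right (fun w hw => hright s t w hst hw (Or.inl hne))
      (pow_deriv_var_pow_mem lam t r))
  have h2 : (deriv lam ^ m) (var k () 0 ^ r * relation k n) - lam ^ e •
      ((deriv lam ^ m) (var k () 0 ^ r) * (deriv lam ^ e) (relation k n)) ∈ N := by
    refine Submodule.span_le.2 ?_ ((isWeightedDerivation_deriv lam).pow_mul _ _ m)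
    rintro _ ⟨s, t, hst, hne, rfl⟩
    rw [SetLike.mem_coe, pow_deriv_relation_eq_smul, mul_smul_comm]
    exact N.smul_mem _ (mul_mem_of_forall_left (fun w hw => hleft s t w hst hw (Or.inl hne))
      (pow_deriv_var_pow_mem lam s r))
  have hcomm : relation k n * var k () 0 ^ r = var k () 0 ^ r * relation k n := by
    rw [relation, sub_mul, mul_sub, one_mul, mul_one, ← pow_add, ← pow_add, add_comm]
  -- Here and in `h4` the cofactor coming from x^r is replaced by its leading term, at the cost of
  -- smaller multiples of relations.
  have h3 : monicRelation lam n m * ((deriv lam ^ e) (var k () 0 ^ r) -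
      lam ^ (e * (r - 1)) • ofWord (topWord lam e r)) ∈ N := by
    have := pow_deriv_var_pow_sub_mem lam e hr
    rw [he, tailIndex_tailIndex, ← he] at this
    exact mul_mem_of_forall_right (fun w hw => hright m e w (isLeibnizPair_tailIndex lam m) hw.1
      (Or.inr hw.2)) this
  have h4 : ((deriv lam ^ m) (var k () 0 ^ r) - lam ^ (e * (r - 1)) • ofWord (topWord lam m r)) *
      monicRelation lam n e ∈ N :=
    mul_mem_of_forall_left (fun w hw => hleft m e w (isLeibnizPair_tailIndex lam m) hw.1
      (Or.inr hw.2)) (pow_deriv_var_pow_sub_mem lam m hr)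
  -- The two expanded elements are equal by `hcomm`, so their dominant terms agree modulo `N`. The
  -- common factors lam^e and lam^(e(n-1)) are then cancelled. The factor lam^(e(r-1)) from `h3` and
  -- `h4` is cancelled last.
  have h5 := N.sub_mem h2 h1
  rw [hcomm, sub_sub_sub_cancel_left, pow_deriv_relation_eq_smul, pow_deriv_relation_eq_smul,
    he, tailIndex_tailIndex, ← he, ← smul_sub, smul_mul_assoc, mul_smul_comm, ← smul_sub,
    N.smul_mem_iff (by simpa [he] using pow_tailIndex_mul_ne_zero lam m 1),
    N.smul_mem_iff (pow_tailIndex_mul_ne_zero lam m (n - 1))] at h5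
  have h6 := N.add_mem (N.sub_mem h5 h3) h4
  rw [← N.smul_mem_iff (pow_tailIndex_mul_ne_zero lam m (r - 1)), ← he]
  convert h6 using 1
  simp only [mul_sub, sub_mul, smul_sub, mul_smul_comm, smul_mul_assoc]
  abel

/-- Write F, G for the two monic relations and F', G' for their leading words. Then F c G' - F' c G
= (F - F') c G - F c (G - G'), and both terms on the right involve only smaller leading words. -/
theorem disjoint_mem_below (hn : 1 ≤ n) (i j : ℕ) (c : Word Unit) :
    monicRelation lam n i * ofWord (c * topWord lam j n) -
        ofWord (topWord lam i n * c) * monicRelation lam n j ∈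
      below lam n (topWord lam i n * c * topWord lam j n) := by
  set N := below lam n (topWord lam i n * c * topWord lam j n) with hN
  have h1 : monicRelation lam n i * ofWord c *
      (monicRelation lam n j - ofWord (topWord lam j n)) ∈ N := by
    refine mul_mem_of_forall_right (fun w hw => ?_) (monicRelation_sub_mem lam hn j)
    rw [mul_assoc, ← ofWord_mul, ← one_mul (monicRelation lam n i), ← ofWord_one]
    refine relationWord_mem_below ?_
    rw [one_mul, ← mul_assoc]
    exact lt_mul_left hw _
  have h2 : (monicRelation lam n i - ofWord (topWord lam i n)) *
      (ofWord c * monicRelation lam n j) ∈ N := by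
    refine mul_mem_of_forall_left (fun w hw => ?_) (monicRelation_sub_mem lam hn i)
    rw [← mul_assoc, ← ofWord_mul, ← mul_one (_ * monicRelation lam n j), ← ofWord_one]
    refine relationWord_mem_below ?_
    rw [mul_one, mul_assoc, mul_assoc]
    exact lt_mul_right hw _
  convert N.sub_mem h2 h1 using 1
  simp only [ofWord_mul, mul_sub, sub_mul, mul_assoc]
  abel

/-- The difference of two multiples of relations with the same leading word is trivial. -/
theorem relationWord_sub_mem_below (hn : 1 ≤ n) (t t' : Word Unit × ℕ × Word Unit)
    (h : relationLead lam n t = relationLead lam n t') :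
    relationWord lam n t - relationWord lam n t' ∈ below lam n (relationLead lam n t) := by
  have key : ∀ (a b b' v : Word Unit) (i j : ℕ),
      topWord lam i n * b = v * topWord lam j n * b' →
      relationWord lam n (a, i, b) - relationWord lam n (a * v, j, b') ∈
        below lam n (a * topWord lam i n * b) := by
    intro a b b' v i j h
    suffices monicRelation lam n i * ofWord b - ofWord v * monicRelation lam n j * ofWord b' ∈
        below lam n (topWord lam i n * b) by
      have := mul_mem_below this a 1
      simpa [relationWord, ofWord_mul, ofWord_one, mul_sub, mul_assoc] using this
    have hl := congrArg FreeMonoid.toList h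
    simp only [FreeMonoid.toList_mul, List.append_assoc] at hl
    have hilen : (topWord lam i n).toList.length = n := length_topWord hn
    have hjlen : (topWord lam j n).toList.length = n := length_topWord hn
    rcases Nat.eq_zero_or_pos v.length with hv | hv
    -- All leading words have the same length `n`, so two of them starting at the same place
    -- coincide, and then so do their indices. Inclusion compositions fall under this case.
    · have hv1 : v = 1 := FreeMonoid.length_eq_zero.1 hv
      subst hv1
      rw [FreeMonoid.toList_one, List.nil_append] at hl
      obtain ⟨h1, h2⟩ := List.append_inj hl (by rw [hilen, hjlen])
      have hij : i = j := topWord_injective (FreeMonoid.toList.injective h1)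
      have hbb : b = b' := FreeMonoid.toList.injective h2
      subst hij hbb
      simp [ofWord_one]
    -- A shift below `n` is a proper overlap, with `u` the part of the right leading word that
    -- sticks out. A shift of at least `n` leaves a gap word `c` between disjoint leading words.
    · rcases lt_or_ge v.length n with hvn | hvn
      · have hblen : v.length ≤ b.toList.length := by
          have := congrArg List.length hl
          simp only [List.length_append, hilen, hjlen] at this
          change _ = v.length + _ at this
          omega
        obtain ⟨u, c, rfl, hu⟩ : ∃ u c : Word Unit, b = u * c ∧ u.length = v.length :=
          ⟨FreeMonoid.ofList (b.toList.take v.length), FreeMonoid.ofList (b.toList.drop v.length),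
            FreeMonoid.toList.injective (List.take_append_drop _ _).symm,
            List.length_take_of_le hblen⟩
        change u.toList.length = v.toList.length at hu
        rw [FreeMonoid.toList_mul, ← List.append_assoc, ← List.append_assoc] at hl
        obtain ⟨h1, h2⟩ := List.append_inj hl (by simp [hilen, hjlen, hu, add_comm])
        have hcb : c = b' := FreeMonoid.toList.injective h2
        subst hcb
        obtain ⟨hj, hu', hv'⟩ := eq_of_overlap (v := v) (u := u) hv hvn rfl
          (FreeMonoid.toList.injective h1)
        have := mul_mem_below (composition_mem_below (lam := lam) hn hv i) 1 c
        rw [← topWord_mul_topWord hn hv, ← hv', ← hu', ← hj] at this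
        simpa [ofWord_one, ofWord_mul, sub_mul, mul_assoc] using this
      · obtain ⟨c, rfl⟩ : ∃ c : Word Unit, v = topWord lam i n * c := by
          have hpre : (topWord lam i n).toList <+: v.toList :=
            List.prefix_of_prefix_length_le ⟨b.toList, rfl⟩ ⟨_, hl.symm⟩ (by rw [hilen]; exact hvn)
          obtain ⟨c, hc⟩ := hpre
          exact ⟨FreeMonoid.ofList c, FreeMonoid.toList.injective hc.symm⟩
        rw [mul_assoc, mul_assoc] at h
        have hb := mul_left_cancel h
        subst hb
        have := mul_mem_below (disjoint_mem_below (lam := lam) hn i j c) 1 b'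
        simpa [ofWord_one, ofWord_mul, sub_mul, mul_assoc] using this
  -- Two prefixes of one word are comparable. So up to exchanging `t` and `t'`, that is up to sign,
  -- the situation is that of `key`.
  have hdiv : ∀ a a' c c' : Word Unit, a * c = a' * c' → a.length ≤ a'.length →
      ∃ v, a' = a * v := by
    intro a a' c c' h hle
    have hpre : a.toList <+: a'.toList :=
      List.prefix_of_prefix_length_le ⟨c.toList, rfl⟩
        ⟨c'.toList, (congrArg FreeMonoid.toList h).symm⟩ hle
    obtain ⟨v, hv⟩ := hpre
    exact ⟨FreeMonoid.ofList v, FreeMonoid.toList.injective hv.symm⟩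
  obtain ⟨a, i, b⟩ := t
  obtain ⟨a', j, b'⟩ := t'
  simp only [relationLead, mul_assoc] at h
  rcases le_total a.length a'.length with hle | hle
  · obtain ⟨v, rfl⟩ := hdiv _ _ _ _ h hle
    rw [mul_assoc] at h
    exact key a b b' v i j (by rw [mul_left_cancel h, mul_assoc])
  · obtain ⟨v, rfl⟩ := hdiv _ _ _ _ h.symm hle
    rw [mul_assoc] at h
    have h' := mul_left_cancel h
    have := key a' b' b v j i (by rw [← h', mul_assoc])
    rw [← neg_sub, Submodule.neg_mem_iff]
    simp only [relationLead, mul_assoc, h']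
    simpa only [mul_assoc] using this

end Confluence

/-! ### Gröbner–Shirshov basis and irreducible words, noncommutative case -/

section Main

variable {k : Type*} [Field k] [DecidableEq k] {lam : k} {n : ℕ}

theorem trivialMod_of_mem_below (hn : 1 ≤ n) {w : Word Unit} {h : Poly k Unit}
    (hh : h ∈ below lam n w) : TrivialMod lam (cyclicSet k n) w h := by
  refine Submodule.span_le.2 ?_ hh
  rintro _ ⟨⟨a, j, b⟩, hlt, rfl⟩
  rw [SetLike.mem_coe, relationWord, monicRelation, mul_smul_comm, smul_mul_assoc]
  exact Submodule.smul_mem _ _ (Submodule.subset_span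
    ⟨relation k n, rfl, j, _, a, b, isLeadingWord_relation lam hn j, hlt, rfl⟩)

theorem isLeadingWord_relation_iff (hn : 1 ≤ n) {m : ℕ} {w : Word Unit} :
    IsLeadingWord ((deriv lam ^ m) (relation k n)) w ↔ w = topWord lam m n :=
  ⟨fun h => h.unique (isLeadingWord_relation lam hn m),
    fun h => h ▸ isLeadingWord_relation lam hn m⟩

/-- Compositions of either kind are differences of two word multiples of monic relations with the
same leading word `w`, so `relationWord_sub_mem_below` covers both. -/
theorem isGroebnerShirshovBasis_cyclicSet (lam : k) (hn : 1 ≤ n) :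
    IsGroebnerShirshovBasis lam (cyclicSet k n) where
  monic := by
    rintro _ rfl
    have h1 := isLeadingWord_relation lam hn 0
    have h2 := coeff_relation lam hn 0
    rw [pow_zero, Module.End.one_apply] at h1 h2
    refine ⟨_, h1, h2.trans ?_⟩
    simp [tailIndex]
  intersection := by
    rintro _ rfl _ rfl i j f₀ g₀ p q u v w hf hg hp hq hw hw' hlen
    change IsLeadingWord (relation k n) f₀ at hf
    change IsLeadingWord (relation k n) g₀ at hg
    change IsLeadingWord ((deriv lam ^ i) (relation k n)) p at hp
    change IsLeadingWord ((deriv lam ^ j) (relation k n)) q at hq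
    change TrivialMod lam _ w ((((deriv lam ^ i) (relation k n)).coeff p)⁻¹ •
      (deriv lam ^ i) (relation k n) * ofWord u - ofWord v *
        (((deriv lam ^ j) (relation k n)).coeff q)⁻¹ • (deriv lam ^ j) (relation k n))
    have h0 := isLeadingWord_relation lam hn 0
    rw [pow_zero, Module.End.one_apply] at h0
    rw [hf.unique h0, hg.unique h0, length_topWord hn] at hlen
    rw [isLeadingWord_relation_iff hn] at hp hq
    subst hp hq hw
    rw [coeff_relation lam hn, coeff_relation lam hn, ← monicRelation, ← monicRelation]
    refine trivialMod_of_mem_below hn ?_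
    have := relationWord_sub_mem_below (lam := lam) hn (1, i, u) (v, j, 1)
      (by simpa [relationLead] using hw')
    simpa [relationWord, relationLead, ofWord_one] using this
  inclusion := by
    rintro _ rfl _ rfl i j p q a b w hp hq hw hw'
    change IsLeadingWord ((deriv lam ^ i) (relation k n)) p at hp
    change IsLeadingWord ((deriv lam ^ j) (relation k n)) q at hq
    change TrivialMod lam _ w ((((deriv lam ^ i) (relation k n)).coeff p)⁻¹ •
      (deriv lam ^ i) (relation k n) - ofWord a *
        (((deriv lam ^ j) (relation k n)).coeff q)⁻¹ • (deriv lam ^ j) (relation k n) * ofWord b)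
    rw [isLeadingWord_relation_iff hn] at hp hq
    subst hp hq hw
    rw [coeff_relation lam hn, coeff_relation lam hn, ← monicRelation, ← monicRelation]
    refine trivialMod_of_mem_below hn ?_
    have := relationWord_sub_mem_below (lam := lam) hn (1, i, 1) (a, j, b)
      (by simpa [relationLead] using hw')
    simpa [relationWord, relationLead, ofWord_one] using this

theorem DIrr_cyclicSet (lam : k) (hn : 1 ≤ n) : DIrr lam (cyclicSet k n) =
    {w | ∀ t, relationLead lam n t ≠ w} := by
  ext w
  constructor
  · rintro h ⟨a, j, b⟩ rfl
    exact h ⟨relation k n, rfl, j, _, a, b, isLeadingWord_relation lam hn j, rfl⟩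
  · rintro h ⟨_, rfl, j, l, a, b, hl, rfl⟩
    exact h (a, j, b) (by rw [(isLeadingWord_relation_iff hn).1 hl]; rfl)

theorem DIrr_cyclicSet_eq_not_isSubword (lam : k) (hn : 1 ≤ n) : DIrr lam (cyclicSet k n) =
    {w | ∀ m, ¬ IsSubword (topWord lam m n) w} := by
  rw [DIrr_cyclicSet lam hn]
  ext w
  constructor
  · rintro h m ⟨a, b, rfl⟩
    exact h (a, m, b) rfl
  · rintro h ⟨a, j, b⟩ rfl
    exact h j ⟨a, b, rfl⟩

/-- Identifies the kernel of the quotient map with the span of the linear family to which the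
composition-diamond lemma is applied. -/
theorem restrictScalars_differentialIdeal_cyclicSet (lam : k) (n : ℕ) :
    (differentialIdeal (deriv₁ lam) (cyclicSet k n)).restrictScalars k =
      Submodule.span k (Set.range (relationWord lam n)) := by
  rw [(isWeightedDerivation_deriv lam).restrictScalars_differentialIdeal]
  apply le_antisymm
  · refine Submodule.span_le.2 ?_
    rintro _ ⟨_, rfl, m, a, b, rfl⟩
    change a * (deriv lam ^ m) (relation k n) * b ∈ _
    have ha : a ∈ Submodule.span k (ofWord '' (Set.univ : Set (Word Unit))) :=
      mem_span_ofWord.2 fun _ _ => trivial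
    have hb : b ∈ Submodule.span k (ofWord '' (Set.univ : Set (Word Unit))) :=
      mem_span_ofWord.2 fun _ _ => trivial
    refine mul_mem_of_forall_right (fun w _ => ?_) hb
    rw [mul_assoc]
    refine mul_mem_of_forall_left (fun v _ => ?_) ha
    rw [← mul_assoc, pow_deriv_relation_eq_smul, mul_smul_comm, smul_mul_assoc]
    exact Submodule.smul_mem _ _ (Submodule.subset_span ⟨(v, m, w), rfl⟩)
  · refine Submodule.span_le.2 ?_
    rintro _ ⟨⟨a, j, b⟩, rfl⟩
    rw [SetLike.mem_coe, relationWord, monicRelation, mul_smul_comm, smul_mul_assoc]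
    exact Submodule.smul_mem _ _ (Submodule.subset_span ⟨relation k n, rfl, j, _, _, rfl⟩)

theorem relationWord_sub_mem (lam : k) (hn : 1 ≤ n) (t : Word Unit × ℕ × Word Unit) :
    relationWord lam n t - (1 : k) • ofWord (relationLead lam n t) ∈
      Submodule.span k (ofWord '' {w | lt w (relationLead lam n t)}) := by
  rw [one_smul, relationWord, relationLead, ofWord_mul, ofWord_mul, ← sub_mul, ← mul_sub,
    mul_assoc (ofWord t.1)]
  refine mul_mem_of_forall_right (B := {w | lt w (topWord lam t.2.1 n * t.2.2)}) (fun w hw => ?_) ?_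
  · rw [← ofWord_mul]
    exact Submodule.subset_span ⟨_, by simpa [mul_assoc] using lt_mul_left hw t.1, rfl⟩
  · refine mul_mem_of_forall_left (fun w hw => ?_) (monicRelation_sub_mem lam hn t.2.1)
    rw [← ofWord_mul]
    exact Submodule.subset_span ⟨_, lt_mul_right hw _, rfl⟩

theorem isBasisFamily_DIrr (lam : k) (hn : 1 ≤ n) :
    IsBasisFamily k fun w : DIrr lam (cyclicSet k n) =>
      toQuotient lam n (ofWord (w : Word Unit)) :=
  isBasisFamily_of_confluent wellFounded_lt (MonoidAlgebra.coeffLinearEquiv k)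
    (fun t => coeff_eq_of_sub_mem (relationWord_sub_mem lam hn t))
    (fun t _ hv hne => lt_of_sub_mem (relationWord_sub_mem lam hn t) hv hne)
    (relationWord_sub_mem_below hn) (toQuotient lam n).toLinearMap
    (toDiffQuotient_surjective _ _)
    ((ker_toDiffQuotient _ _).trans (restrictScalars_differentialIdeal_cyclicSet lam n))
    (DIrr_cyclicSet lam hn)

end Main

end NC

/-! ### Universal property, noncommutative case -/

namespace NC

section Universal

variable {k : Type*} [Field k] {R : Type*} [Ring R] [Algebra k R] {lam : k} {n : ℕ}

/-- The homomorphism of differential algebras from `k⟨Δ(x)⟩` which maps `x` to `a`. -/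
noncomputable def evalHom (d : R →ₗ[k] R) (a : R) : Poly k Unit →ₐ[k] R :=
  MonoidAlgebra.lift k R (Word Unit) (FreeMonoid.lift fun l => (d ^ (ofLex l).1) a)

theorem evalHom_ofWord (d : R →ₗ[k] R) (a : R) (w : Word Unit) :
    evalHom d a (ofWord w) = FreeMonoid.lift (fun l : Letter Unit => (d ^ (ofLex l).1) a) w :=
  MonoidAlgebra.lift_of _ _

theorem evalHom_var (d : R →ₗ[k] R) (a : R) (m : ℕ) : evalHom d a (var k () m) = (d ^ m) a := by
  rw [var, evalHom_ofWord, FreeMonoid.lift_eval_of]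
  rfl

theorem evalHom_deriv {d : R →ₗ[k] R} (hd : IsWeightedDerivation lam d) (a : R)
    (p : Poly k Unit) : evalHom d a (deriv lam p) = d (evalHom d a p) := by
  have hp : p ∈ Submodule.span k (Set.range (ofWord : Word Unit → Poly k Unit)) := by
    rw [span_range_ofWord]; trivial
  induction hp using Submodule.span_induction with
  | mem x hx =>
    obtain ⟨w, rfl⟩ := hx
    induction w using FreeMonoid.inductionOn' with
    | one => rw [ofWord_one, deriv_one, map_zero, map_one, hd.map_one]
    | of_mul l w ih =>
      have hl : evalHom d a (ofWord (FreeMonoid.of l.succ)) =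
          d (evalHom d a (ofWord (FreeMonoid.of l))) := by
        rw [evalHom_ofWord, evalHom_ofWord, FreeMonoid.lift_eval_of, FreeMonoid.lift_eval_of,
          ← Module.End.mul_apply, ← pow_succ']
        rfl
      rw [deriv_ofWord_of_mul, ofWord_mul, map_mul, hd.leibniz, map_add, map_add, map_smul,
        map_mul, map_mul, map_mul, ih, hl]
  | zero => simp
  | add x y _ _ hx hy => simp only [map_add, hx, hy]
  | smul c x _ hx => simp only [map_smul, hx]

/-- Every letter is an iterated derivative of x^(0), so the value at x^(0) determines a differential
homomorphism. -/
theorem eq_evalHom {d : R →ₗ[k] R} (ψ : Poly k Unit →ₐ[k] R)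
    (hψ : ∀ x, ψ (deriv lam x) = d (ψ x)) : ψ = evalHom d (ψ (var k () 0)) := by
  refine MonoidAlgebra.algHom_ext' (FreeMonoid.hom_eq fun l => ?_) (by ext)
  have h : ∀ m, ψ (var k () m) = (d ^ m) (ψ (var k () 0)) := by
    intro m
    induction m with
    | zero => rfl
    | succ m ih =>
      rw [← pow_deriv_var lam () (m + 1), pow_succ', pow_succ', Module.End.mul_apply,
        Module.End.mul_apply, pow_deriv_var, hψ, ih]
  exact (h (ofLex l).1).trans (evalHom_var d (ψ (var k () 0)) (ofLex l).1).symm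

theorem toQuotient_var_pow (lam : k) (n : ℕ) : toQuotient lam n (var k () 0) ^ n = 1 := by
  have : toQuotient lam n (var k () 0 ^ n - 1) = 0 :=
    Ideal.Quotient.eq_zero_iff_mem.2
      (pow_mem_differentialIdeal (deriv₁ lam) (U := cyclicSet k n) rfl 0)
  rwa [map_sub, map_pow, map_one, sub_eq_zero] at this

/-- Both sides are parametrised by elements `a` of `R` with `a ^ n = 1`: the image of `g` on one
side, the image of x^(0) on the other. -/
theorem isFreeDifferentialAlgebra_cyclicQuotient.{v₁, u₁, w₁} {k : Type u₁} [Field k] {lam : k} {n : ℕ}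
    {G : Type w₁} [Group G] {g : G} (hG : Nat.card G = n) (hg : ∀ h : G, h ∈ Subgroup.zpowers g)
    {i : MonoidAlgebra k G →ₐ[k] CyclicQuotient lam n}
    (hi : i (MonoidAlgebra.of k G g) = toQuotient lam n (var k () 0)) :
    IsFreeDifferentialAlgebra.{v₁} lam (cyclicDeriv lam n) i where
  derivation := (isWeightedDerivation_deriv lam).quotientDerivation _
  universal := by
    intro R _ _ d hd φ
    have ha : φ (MonoidAlgebra.of k G g) ^ n = 1 := algHom_generator_pow hG φ
    obtain ⟨χ, h1, h2⟩ := exists_lift_of_map_eq_zero (d := deriv₁ lam) d (cyclicSet k n)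
      (evalHom d (φ (MonoidAlgebra.of k G g))) (evalHom_deriv hd _) (by
        rintro _ rfl
        rw [map_sub, map_pow, evalHom_var, map_one, pow_zero, Module.End.one_apply, ha, sub_self])
    have hgen : ∀ ψ : CyclicQuotient lam n →ₐ[k] R, ψ.comp i = φ ↔
        ψ (toQuotient lam n (var k () 0)) = φ (MonoidAlgebra.of k G g) := by
      intro ψ
      rw [← hi]
      exact ⟨fun h => DFunLike.congr_fun h _, fun h => algHom_ext_of_generator hg h⟩
    refine ⟨χ, ⟨h2, (hgen χ).2 ?_⟩, ?_⟩
    · exact (DFunLike.congr_fun h1 (var k () 0)).trans (evalHom_var _ _ 0)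
    · rintro ψ ⟨h3, h4⟩
      have h5 : ψ.comp (toQuotient lam n) = χ.comp (toQuotient lam n) := by
        refine (eq_evalHom (lam := lam) (d := d) (ψ.comp (toQuotient lam n))
          fun x => h3 (toQuotient lam n x)).trans (Eq.trans ?_ h1.symm)
        rw [AlgHom.comp_apply, (hgen ψ).1 h4]
      refine AlgHom.ext fun x => ?_
      obtain ⟨x, rfl⟩ := toDiffQuotient_surjective _ _ x
      exact DFunLike.congr_fun h5 x

end Universal

end NC

/-! ### Commutative polynomials: derivation and monomial order -/

namespace Comm

section General

variable {k X : Type*} [Field k]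

theorem ofWord_add (v w : Word X) : (ofWord (v + w) : Poly k X) = ofWord v * ofWord w := by
  rw [ofWord, ofWord, ofWord, MvPolynomial.monomial_mul, one_mul]

theorem ofWord_zero : (ofWord 0 : Poly k X) = 1 := rfl

theorem ofWord_single (a : Letter X) : (ofWord (Finsupp.single a 1) : Poly k X) = MvPolynomial.X a :=
  rfl

theorem word_induction {P : Word X → Prop} (zero : P 0)
    (add : ∀ a w, P w → P (Finsupp.single a 1 + w)) (w : Word X) : P w := by
  classical
  rw [← Finsupp.toMultiset_toFinsupp w]
  induction Finsupp.toMultiset w using Multiset.induction with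
  | empty => rwa [map_zero]
  | cons a s ih =>
    rw [← Multiset.singleton_add, map_add, Multiset.toFinsupp_singleton]
    exact add a _ ih

theorem toMultiset_single_add (a : Letter X) (w : Word X) :
    Finsupp.toMultiset (Finsupp.single a 1 + w) = a ::ₘ Finsupp.toMultiset w := by
  rw [map_add, Finsupp.toMultiset_single, one_smul, Multiset.singleton_add]

/-- The polynomials all of whose words belong to `A`. -/
theorem mem_span_ofWord {A : Set (Word X)} {p : Poly k X} :
    p ∈ Submodule.span k (ofWord '' A) ↔ ∀ w, p.coeff w ≠ 0 → w ∈ A := by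
  classical
  constructor
  · intro hp
    induction hp using Submodule.span_induction with
    | mem x hx =>
      obtain ⟨v, hv, rfl⟩ := hx
      intro w hw
      rw [ofWord, MvPolynomial.coeff_monomial] at hw
      split_ifs at hw with h
      · exact h ▸ hv
      · exact absurd rfl hw
    | zero => intro w hw; simp at hw
    | add x y _ _ hx hy =>
      intro w hw
      by_cases h : x.coeff w = 0
      · exact hy w (fun h' => hw (by rw [MvPolynomial.coeff_add, h, h', add_zero]))
      · exact hx w h
    | smul c x _ hx =>
      intro w hw
      exact hx w (fun h' => hw (by rw [MvPolynomial.coeff_smul, h', smul_zero]))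
  · intro h
    rw [← MvPolynomial.support_sum_monomial_coeff p]
    refine Submodule.sum_mem _ fun w hw => ?_
    have : MvPolynomial.monomial w (p.coeff w) = p.coeff w • (ofWord w : Poly k X) := by
      rw [ofWord, MvPolynomial.smul_monomial, smul_eq_mul, mul_one]
    rw [this]
    exact Submodule.smul_mem _ _
      (Submodule.subset_span ⟨w, h w (MvPolynomial.mem_support_iff.1 hw), rfl⟩)

theorem mul_mem_of_forall_word {B : Set (Word X)} {N : Submodule k (Poly k X)} {p q : Poly k X}
    (h : ∀ w ∈ B, p * ofWord w ∈ N) (hq : q ∈ Submodule.span k (ofWord '' B)) : p * q ∈ N := by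
  have : Submodule.span k (ofWord '' B) ≤ N.comap (LinearMap.mulLeft k p) := by
    rw [Submodule.span_le]
    rintro _ ⟨w, hw, rfl⟩
    exact h w hw
  exact this hq

theorem span_range_ofWord : Submodule.span k (Set.range (ofWord : Word X → Poly k X)) = ⊤ := by
  rw [eq_top_iff, ← Set.image_univ]
  exact fun p _ => mem_span_ofWord.2 fun w _ => Set.mem_univ w

theorem deriv_ofWord (lam : k) (w : Word X) :
    deriv lam (ofWord w) = derivWord lam (Finsupp.toMultiset w) := by
  have := (MvPolynomial.basisMonomials (Letter X) k).constr_basis k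
    (fun w => derivWord lam (Finsupp.toMultiset w)) w
  rwa [MvPolynomial.coe_basisMonomials] at this

/-- The first component of the fold records the word read so far. With this the second component
obeys the Leibniz recursion. -/
theorem foldr_derivStep_fst (lam : k) (w : Word X) :
    ((Finsupp.toMultiset w).foldr (derivStep lam) (1, 0)).1 = ofWord w := by
  induction w using word_induction with
  | zero => rw [map_zero]; rfl
  | add a w ih =>
    rw [toMultiset_single_add, Multiset.foldr_cons, derivStep, ih, ofWord_add]
    rfl

theorem deriv_ofWord_single_add (lam : k) (a : Letter X) (w : Word X) :
    deriv lam (ofWord (Finsupp.single a 1 + w)) =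
      MvPolynomial.X a.succ * ofWord w + MvPolynomial.X a * deriv lam (ofWord w) +
        lam • (MvPolynomial.X a.succ * deriv lam (ofWord w)) := by
  rw [deriv_ofWord, deriv_ofWord, derivWord, toMultiset_single_add, Multiset.foldr_cons, derivStep,
    foldr_derivStep_fst]
  rfl

theorem deriv_one (lam : k) : deriv lam (1 : Poly k X) = 0 := by
  rw [← ofWord_zero, deriv_ofWord, map_zero]
  rfl

theorem deriv_X (lam : k) (a : Letter X) :
    deriv lam (MvPolynomial.X a : Poly k X) = MvPolynomial.X a.succ := by
  rw [← ofWord_single, ← add_zero (Finsupp.single a 1), deriv_ofWord_single_add, ofWord_zero,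
    deriv_one]
  simp

theorem deriv_ofWord_mul (lam : k) (v w : Word X) :
    deriv lam (ofWord v * ofWord w) = deriv lam (ofWord v) * ofWord w +
      ofWord v * deriv lam (ofWord w) + lam • (deriv lam (ofWord v) * deriv lam (ofWord w)) := by
  induction v using word_induction with
  | zero => simp [ofWord_zero, deriv_one]
  | add a v ih =>
    rw [← ofWord_add, add_assoc, deriv_ofWord_single_add, deriv_ofWord_single_add, ofWord_add,
      ofWord_add, ih, ofWord_single]
    simp only [mul_add, add_mul, smul_add, mul_smul_comm, smul_mul_assoc, mul_assoc]
    abel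

theorem isWeightedDerivation_deriv (lam : k) :
    IsWeightedDerivation lam (deriv lam : Poly k X →ₗ[k] Poly k X) where
  map_one := deriv_one lam
  leibniz := by
    intro p q
    have hp : p ∈ Submodule.span k (Set.range (ofWord : Word X → Poly k X)) := by
      rw [span_range_ofWord]; trivial
    have hq : q ∈ Submodule.span k (Set.range (ofWord : Word X → Poly k X)) := by
      rw [span_range_ofWord]; trivial
    induction hp using Submodule.span_induction with
    | mem x hx =>
      obtain ⟨v, rfl⟩ := hx
      induction hq using Submodule.span_induction with
      | mem y hy =>
        obtain ⟨w, rfl⟩ := hy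
        exact deriv_ofWord_mul lam v w
      | zero => simp
      | add y z _ _ hy hz =>
        simp only [mul_add, map_add, hy, hz, smul_add]
        abel
      | smul c y _ hy =>
        simp only [mul_smul_comm, map_smul, hy, smul_add, smul_comm lam c]
    | zero => simp
    | add x y _ _ hx hy =>
      simp only [add_mul, map_add, hx, hy, smul_add]
      abel
    | smul c x _ hx =>
      simp only [smul_mul_assoc, map_smul, hx, smul_add, smul_comm lam c]

theorem pow_deriv_var (lam : k) (x : X) (m : ℕ) : (deriv lam ^ m) (var k x 0) = var k x m := by
  induction m with
  | zero => rfl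
  | succ m ih =>
    rw [pow_succ', Module.End.mul_apply, ih, var, deriv_X]
    rfl

section Order

variable [LinearOrder X]

theorem coe_letters (w : Word X) : (letters w : Multiset (Letter X)) = Finsupp.toMultiset w :=
  Multiset.sort_eq _ _

theorem letters_injective : Function.Injective (letters : Word X → List (Letter X)) := by
  intro v w h
  classical
  rw [← Finsupp.toMultiset_toFinsupp v, ← Finsupp.toMultiset_toFinsupp w, ← coe_letters,
    ← coe_letters, h]

theorem length_letters (w : Word X) : (letters w).length = w.degree := by
  rw [← Multiset.coe_card, coe_letters, Finsupp.card_toMultiset]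
  rfl

theorem letters_single_add (a : Letter X) (w : Word X) :
    letters (Finsupp.single a 1 + w) = (letters w).orderedInsert (fun a b => b ≤ a) a := by
  rw [letters, letters, toMultiset_single_add]
  refine Quotient.inductionOn (Finsupp.toMultiset w) fun l => ?_
  simp [List.mergeSort_eq_insertionSort]

theorem lt_iff {u v : Word X} : lt u v ↔ u.degree < v.degree ∨
    u.degree = v.degree ∧ List.Lex (· < ·) (letters u) (letters v) := by
  rw [← length_letters, ← length_letters]
  exact List.shortlex_def

instance isStrictTotalOrder_lt : IsStrictTotalOrder (Word X) lt where
  trichotomous := fun u v h h' =>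
    letters_injective (Std.Trichotomous.trichotomous (r := List.Shortlex (· < ·)) _ _ h h')
  irrefl := fun u h => (irrefl_of (List.Shortlex (· < ·)) (letters u)) h
  trans := by
    intro u v w h h'
    rw [lt_iff] at *
    rcases h with h | ⟨h, hl⟩ <;> rcases h' with h' | ⟨h', hl'⟩
    · exact Or.inl (h.trans h')
    · exact Or.inl (h' ▸ h)
    · exact Or.inl (h ▸ h')
    · exact Or.inr ⟨h.trans h', List.lt_trans hl hl'⟩

theorem wellFounded_lt [WellFoundedLT X] : WellFounded (lt : Word X → Word X → Prop) :=
  InvImage.wf _ (List.Shortlex.wf _root_.wellFounded_lt)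

/-- The letter `a` goes in front of the first entry that is at most `a`. If the heads agree, it is
placed alike in both lists. If they differ, the larger of `a` and the head leads each list, and the
comparison stays strict unless `a` leads both, where it moves to the old heads. This is the
compatibility of the order with multiplication by a letter. -/
theorem lex_orderedInsert {α : Type*} [LinearOrder α] {s t : List α} (h : List.Lex (· < ·) s t)
    (hlen : s.length = t.length) (a : α) :
    List.Lex (· < ·) (s.orderedInsert (fun a b => b ≤ a) a)
      (t.orderedInsert (fun a b => b ≤ a) a) := by
  induction h with
  | nil => simp at hlen
  | @cons b s t h ih =>
    rw [List.orderedInsert_cons, List.orderedInsert_cons]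
    split_ifs
    · exact List.Lex.cons (List.Lex.cons h)
    · exact List.Lex.cons (ih (by simpa using hlen))
  | @rel b s c t h =>
    rw [List.orderedInsert_cons, List.orderedInsert_cons]
    split_ifs with h1 h2 h2
    · exact List.Lex.cons (List.Lex.rel h)
    · exact List.Lex.rel (not_le.1 h2)
    · exact absurd (h.le.trans h2) h1
    · exact List.Lex.rel h

theorem lt_add_left {u v : Word X} (h : lt u v) (w : Word X) : lt (w + u) (w + v) := by
  induction w using word_induction with
  | zero => simpa using h
  | add a w ih =>
    rw [lt_iff] at ih ⊢
    rw [add_assoc, add_assoc, letters_single_add, letters_single_add]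
    simp only [map_add] at ih ⊢
    rcases ih with ih | ⟨ih, hl⟩
    · left; omega
    · exact Or.inr ⟨by omega, lex_orderedInsert hl (by simpa [length_letters] using ih) a⟩

theorem IsLeadingWord.unique {f : Poly k X} {v w : Word X} (hv : IsLeadingWord f v)
    (hw : IsLeadingWord f w) : v = w := by
  by_contra hne
  exact asymm_of lt (hv.2 w hw.1 (Ne.symm hne)) (hw.2 v hv.1 hne)

theorem coeff_eq_of_sub_mem {f : Poly k X} {w : Word X} {c : k}
    (h : f - c • ofWord w ∈ Submodule.span k (ofWord '' {v | lt v w})) : f.coeff w = c := by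
  classical
  by_contra hne
  refine irrefl_of lt w (mem_span_ofWord.1 h w ?_)
  rw [MvPolynomial.coeff_sub, MvPolynomial.coeff_smul, ofWord, MvPolynomial.coeff_monomial,
    if_pos rfl, smul_eq_mul, mul_one]
  exact sub_ne_zero.2 hne

theorem lt_of_sub_mem {f : Poly k X} {w : Word X} {c : k}
    (h : f - c • ofWord w ∈ Submodule.span k (ofWord '' {v | lt v w})) {v : Word X}
    (hv : f.coeff v ≠ 0) (hne : v ≠ w) : lt v w := by
  classical
  refine mem_span_ofWord.1 h v ?_
  rwa [MvPolynomial.coeff_sub, MvPolynomial.coeff_smul, ofWord, MvPolynomial.coeff_monomial,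
    if_neg hne.symm, smul_zero, sub_zero]

theorem isLeadingWord_of_sub_mem {f : Poly k X} {w : Word X} {c : k} (hc : c ≠ 0)
    (h : f - c • ofWord w ∈ Submodule.span k (ofWord '' {v | lt v w})) : IsLeadingWord f w :=
  ⟨MvPolynomial.mem_support_iff.2 (by rwa [coeff_eq_of_sub_mem h]),
    fun _ hv hne => lt_of_sub_mem h (MvPolynomial.mem_support_iff.1 hv) hne⟩

end Order

end General

/-! ### Universal property, commutative case -/

section Universal

variable {k : Type*} [Field k] {R : Type*} [CommRing R] [Algebra k R] {lam : k} {n : ℕ}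

/-- The homomorphism of differential algebras from `k[Δ(x)]` which maps `x` to `a`. -/
noncomputable def evalHom (d : R →ₗ[k] R) (a : R) : Poly k Unit →ₐ[k] R :=
  MvPolynomial.aeval fun l : Letter Unit => (d ^ (ofLex l).1) a

theorem evalHom_var (d : R →ₗ[k] R) (a : R) (m : ℕ) : evalHom d a (var k () m) = (d ^ m) a :=
  MvPolynomial.aeval_X _ _

theorem evalHom_deriv {d : R →ₗ[k] R} (hd : IsWeightedDerivation lam d) (a : R)
    (p : Poly k Unit) : evalHom d a (deriv lam p) = d (evalHom d a p) := by
  have hp : p ∈ Submodule.span k (Set.range (ofWord : Word Unit → Poly k Unit)) := by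
    rw [span_range_ofWord]; trivial
  induction hp using Submodule.span_induction with
  | mem x hx =>
    obtain ⟨w, rfl⟩ := hx
    induction w using word_induction with
    | zero => rw [ofWord_zero, deriv_one, map_zero, map_one, hd.map_one]
    | add l w ih =>
      have hl : evalHom d a (MvPolynomial.X l.succ) = d (evalHom d a (MvPolynomial.X l)) := by
        rw [evalHom, MvPolynomial.aeval_X, MvPolynomial.aeval_X, ← Module.End.mul_apply,
          ← pow_succ']
        rfl
      rw [deriv_ofWord_single_add, ofWord_add, map_mul, hd.leibniz, map_add, map_add, map_smul,
        map_mul, map_mul, map_mul, ih, hl, ofWord_single]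
  | zero => simp
  | add x y _ _ hx hy => simp only [map_add, hx, hy]
  | smul c x _ hx => simp only [map_smul, hx]

theorem eq_evalHom {d : R →ₗ[k] R} (ψ : Poly k Unit →ₐ[k] R)
    (hψ : ∀ x, ψ (deriv lam x) = d (ψ x)) : ψ = evalHom d (ψ (var k () 0)) := by
  refine MvPolynomial.algHom_ext fun l => ?_
  have h : ∀ m, ψ (var k () m) = (d ^ m) (ψ (var k () 0)) := by
    intro m
    induction m with
    | zero => rfl
    | succ m ih =>
      rw [← pow_deriv_var lam () (m + 1), pow_succ', pow_succ', Module.End.mul_apply,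
        Module.End.mul_apply, pow_deriv_var, hψ, ih]
  exact (h (ofLex l).1).trans (evalHom_var d (ψ (var k () 0)) (ofLex l).1).symm

theorem toQuotient_var_pow (lam : k) (n : ℕ) : toQuotient lam n (var k () 0) ^ n = 1 := by
  have : toQuotient lam n (var k () 0 ^ n - 1) = 0 :=
    Ideal.Quotient.eq_zero_iff_mem.2
      (pow_mem_differentialIdeal (deriv₁ lam) (U := cyclicSet k n) rfl 0)
  rwa [map_sub, map_pow, map_one, sub_eq_zero] at this

theorem isFreeCommDifferentialAlgebra_cyclicQuotient.{v₁, u₁, w₁} {k : Type u₁} [Field k] {lam : k}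
    {n : ℕ} {G : Type w₁} [Group G] {g : G} (hG : Nat.card G = n)
    (hg : ∀ h : G, h ∈ Subgroup.zpowers g) {i : MonoidAlgebra k G →ₐ[k] CyclicQuotient lam n}
    (hi : i (MonoidAlgebra.of k G g) = toQuotient lam n (var k () 0)) :
    IsFreeCommDifferentialAlgebra.{v₁} lam (cyclicDeriv lam n) i where
  derivation := (isWeightedDerivation_deriv lam).quotientDerivation _
  universal := by
    intro R _ _ d hd φ
    have ha : φ (MonoidAlgebra.of k G g) ^ n = 1 := algHom_generator_pow hG φ
    obtain ⟨χ, h1, h2⟩ := exists_lift_of_map_eq_zero (d := deriv₁ lam) d (cyclicSet k n)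
      (evalHom d (φ (MonoidAlgebra.of k G g))) (evalHom_deriv hd _) (by
        rintro _ rfl
        rw [map_sub, map_pow, evalHom_var, map_one, pow_zero, Module.End.one_apply, ha, sub_self])
    have hgen : ∀ ψ : CyclicQuotient lam n →ₐ[k] R, ψ.comp i = φ ↔
        ψ (toQuotient lam n (var k () 0)) = φ (MonoidAlgebra.of k G g) := by
      intro ψ
      rw [← hi]
      exact ⟨fun h => DFunLike.congr_fun h _, fun h => algHom_ext_of_generator hg h⟩
    refine ⟨χ, ⟨h2, (hgen χ).2 ?_⟩, ?_⟩
    · exact (DFunLike.congr_fun h1 (var k () 0)).trans (evalHom_var _ _ 0)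
    · rintro ψ ⟨h3, h4⟩
      have h5 : ψ.comp (toQuotient lam n) = χ.comp (toQuotient lam n) := by
        refine (eq_evalHom (lam := lam) (d := d) (ψ.comp (toQuotient lam n))
          fun x => h3 (toQuotient lam n x)).trans (Eq.trans ?_ h1.symm)
        rw [AlgHom.comp_apply, (hgen ψ).1 h4]
      refine AlgHom.ext fun x => ?_
      obtain ⟨x, rfl⟩ := toDiffQuotient_surjective _ _ x
      exact DFunLike.congr_fun h5 x

end Universal

end Comm

/-! ### Leading terms in k[Δ(x)] by projection from k⟨Δ(x)⟩ -/

namespace Comm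

section Leading

variable {k : Type*} [Field k] {lam : k} {n : ℕ}

/-- The commutative word with the letters of a given word. -/
noncomputable def abel (w : NC.Word Unit) : Word Unit :=
  Multiset.toFinsupp (w.toList : Multiset (Letter Unit))

theorem abel_of_mul (a : Letter Unit) (w : NC.Word Unit) :
    abel (FreeMonoid.of a * w) = Finsupp.single a 1 + abel w := by
  rw [abel, abel, FreeMonoid.toList_of_mul, ← Multiset.cons_coe, ← Multiset.singleton_add, map_add,
    Multiset.toFinsupp_singleton]

theorem toMultiset_abel (w : NC.Word Unit) : Finsupp.toMultiset (abel w) = w.toList :=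
  Multiset.toFinsupp_toMultiset _

theorem degree_abel (w : NC.Word Unit) : (abel w).degree = w.length := by
  rw [← length_letters, ← Multiset.coe_card, coe_letters, toMultiset_abel]
  rfl

theorem coe_eq_replicate_iff {α : Type*} {l : List α} {n : ℕ} {a : α} :
    (l : Multiset α) = Multiset.replicate n a ↔ l = List.replicate n a := by
  rw [← Multiset.coe_replicate, Multiset.coe_eq_coe, List.perm_replicate]

/-- The projection of `k⟨Δ(x)⟩` onto `k[Δ(x)]`. -/
noncomputable def abelHom (lam : k) : NC.Poly k Unit →ₐ[k] Poly k Unit :=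
  NC.evalHom (deriv lam) (var k () 0)

theorem abelHom_ofWord (lam : k) (w : NC.Word Unit) :
    abelHom lam (NC.ofWord w) = ofWord (abel w) := by
  induction w using FreeMonoid.inductionOn' with
  | one =>
    rw [NC.ofWord_one, map_one, ← ofWord_zero]
    congr 1
  | of_mul a w ih =>
    rw [NC.ofWord_mul, map_mul, ih, abel_of_mul, ofWord_add, ofWord_single]
    congr 1
    exact (NC.evalHom_var _ _ (ofLex a).1).trans (pow_deriv_var lam () (ofLex a).1)

theorem abelHom_pow_deriv (lam : k) (m : ℕ) (p : NC.Poly k Unit) :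
    abelHom lam ((NC.deriv lam ^ m) p) = (deriv lam ^ m) (abelHom lam p) := by
  induction m with
  | zero => rfl
  | succ m ih =>
    rw [pow_succ', pow_succ', Module.End.mul_apply, Module.End.mul_apply, ← ih]
    exact NC.evalHom_deriv (isWeightedDerivation_deriv lam) _ _

theorem letters_single (a : Letter Unit) (n : ℕ) :
    letters (Finsupp.single a n) = List.replicate n a := by
  rw [← coe_eq_replicate_iff, coe_letters, Finsupp.toMultiset_single,
    Multiset.nsmul_singleton]

/-- Against a constant word the arrangement of the letters is irrelevant, so the noncommutative
comparison `NC.lex_replicate` applies to the sorted list. -/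
theorem lt_single_of_forall_le {w : Word Unit} {m r : ℕ} (hr : w.degree = r)
    (hle : ∀ a ∈ Finsupp.toMultiset w, (ofLex a).1 ≤ m) (hne : w ≠ Finsupp.single (letter () m) r) :
    lt w (Finsupp.single (letter () m) r) := by
  have hlen : (letters w).length = r := by rw [length_letters, hr]
  rw [lt_iff, letters_single, Finsupp.degree_single, ← hlen]
  refine Or.inr ⟨(length_letters w).symm, NC.lex_replicate (fun a ha => hle a ?_) fun h => hne ?_⟩
  · rwa [← coe_letters]
  · apply letters_injective
    rw [h, letters_single, hlen]

/-- The element `x^n - 1`. -/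
noncomputable def relation (k : Type*) [Field k] (n : ℕ) : Poly k Unit := var k () 0 ^ n - 1

theorem pow_deriv_one (lam : k) (m : ℕ) :
    (deriv lam ^ m) (1 : Poly k Unit) = if m = 0 then 1 else 0 := by
  cases m with
  | zero => rfl
  | succ m => rw [pow_succ, Module.End.mul_apply, deriv_one, map_zero, if_neg (Nat.succ_ne_zero m)]

theorem pow_deriv_relation (lam : k) (n m : ℕ) : (deriv lam ^ m) (relation k n) =
    (deriv lam ^ m) (var k () 0 ^ n) - if m = 0 then 1 else 0 := by
  rw [relation, map_sub, pow_deriv_one]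

/-- Projects the noncommutative expansion. For `lam ≠ 0` the top word is the constant word
x^(m)⋯x^(m), and no other word has the same commutative image, so the leading coefficient is
unchanged. -/
theorem pow_deriv_var_pow_sub_mem (hl : lam ≠ 0) (hn : 1 ≤ n) (m : ℕ) :
    (deriv lam ^ m) (var k () 0 ^ n) -
        lam ^ (m * (n - 1)) • ofWord (Finsupp.single (letter () m) n) ∈
      Submodule.span k (ofWord '' {w | lt w (Finsupp.single (letter () m) n)}) := by
  classical
  have hm : tailIndex lam m = m := if_neg hl
  have htop : abel (NC.topWord lam m n) = Finsupp.single (letter () m) n := by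
    apply letters_injective
    rw [letters_single, ← coe_eq_replicate_iff, coe_letters, toMultiset_abel,
      NC.toList_topWord, hm, ← List.replicate_succ, Nat.sub_add_cancel hn, Multiset.coe_replicate]
  have h := Submodule.mem_map_of_mem (f := (abelHom lam).toLinearMap)
    (NC.pow_deriv_var_pow_sub_mem lam m hn)
  rw [Submodule.map_span, hm] at h
  have hx : abelHom lam (NC.var k () 0) = var k () 0 := NC.evalHom_var _ _ 0
  have heq : (abelHom lam).toLinearMap ((NC.deriv lam ^ m) (NC.var k () 0 ^ n) -
      lam ^ (m * (n - 1)) • NC.ofWord (NC.topWord lam m n)) = (deriv lam ^ m) (var k () 0 ^ n) -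
        lam ^ (m * (n - 1)) • ofWord (Finsupp.single (letter () m) n) := by
    rw [AlgHom.toLinearMap_apply, map_sub, map_smul, abelHom_pow_deriv, abelHom_ofWord, map_pow,
      hx, htop]
  rw [heq] at h
  refine Submodule.span_le.2 ?_ h
  rintro _ ⟨_, ⟨w, ⟨⟨hlen, hle, -⟩, hne⟩, rfl⟩, rfl⟩
  rw [AlgHom.toLinearMap_apply, abelHom_ofWord]
  refine Submodule.subset_span ⟨_, lt_single_of_forall_le (by rw [degree_abel, hlen]) ?_ ?_, rfl⟩
  · intro a ha
    rw [toMultiset_abel] at ha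
    exact hle a ha
  -- A multiset of equal letters has only one arrangement.
  · intro h
    refine hne (FreeMonoid.toList.injective ?_)
    have h' := congrArg Finsupp.toMultiset h
    rw [toMultiset_abel, Finsupp.toMultiset_single, Multiset.nsmul_singleton,
      coe_eq_replicate_iff] at h'
    rw [h', NC.toList_topWord, hm, ← List.replicate_succ, Nat.sub_add_cancel hn]

theorem pow_deriv_relation_sub_mem (hl : lam ≠ 0) (hn : 1 ≤ n) (m : ℕ) :
    (deriv lam ^ m) (relation k n) -
        lam ^ (m * (n - 1)) • ofWord (Finsupp.single (letter () m) n) ∈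
      Submodule.span k (ofWord '' {w | lt w (Finsupp.single (letter () m) n)}) := by
  rw [pow_deriv_relation, sub_right_comm]
  refine Submodule.sub_mem _ (pow_deriv_var_pow_sub_mem hl hn m) ?_
  split_ifs
  · rw [← ofWord_zero]
    refine Submodule.subset_span ⟨0, lt_iff.2 (Or.inl ?_), rfl⟩
    rw [Finsupp.degree_single, map_zero]
    exact hn
  · exact Submodule.zero_mem _

/-- The element `d^m (x^n - 1)` divided by its leading coefficient. -/
noncomputable def monicRelation (lam : k) (n m : ℕ) : Poly k Unit :=
  (lam ^ (m * (n - 1)))⁻¹ • (deriv lam ^ m) (relation k n)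

theorem isLeadingWord_relation_iff (hl : lam ≠ 0) (hn : 1 ≤ n) {m : ℕ} {w : Word Unit} :
    IsLeadingWord ((deriv lam ^ m) (relation k n)) w ↔ w = Finsupp.single (letter () m) n := by
  have := isLeadingWord_of_sub_mem (pow_ne_zero _ hl) (pow_deriv_relation_sub_mem hl hn m)
  exact ⟨fun h => h.unique this, fun h => h ▸ this⟩

theorem coeff_relation (hl : lam ≠ 0) (hn : 1 ≤ n) (m : ℕ) :
    ((deriv lam ^ m) (relation k n)).coeff (Finsupp.single (letter () m) n) =
      lam ^ (m * (n - 1)) :=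
  coeff_eq_of_sub_mem (pow_deriv_relation_sub_mem hl hn m)

theorem monicRelation_sub_mem (hl : lam ≠ 0) (hn : 1 ≤ n) (m : ℕ) :
    monicRelation lam n m - ofWord (Finsupp.single (letter () m) n) ∈
      Submodule.span k (ofWord '' {w | lt w (Finsupp.single (letter () m) n)}) := by
  have := Submodule.smul_mem _ (lam ^ (m * (n - 1)))⁻¹ (pow_deriv_relation_sub_mem hl hn m)
  rwa [smul_sub, smul_smul, inv_mul_cancel₀ (pow_ne_zero _ hl), one_smul] at this

theorem pow_deriv_relation_eq_smul (hl : lam ≠ 0) (n m : ℕ) : (deriv lam ^ m) (relation k n) =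
    lam ^ (m * (n - 1)) • monicRelation lam n m := by
  rw [monicRelation, smul_smul, mul_inv_cancel₀ (pow_ne_zero _ hl), one_smul]

end Leading

/-! ### Triviality of compositions and irreducible words, commutative case -/

section Confluence

variable {k : Type*} [Field k] {lam : k} {n : ℕ}

/-- The element `d^j(x^n - 1) · u`, `t = (j, u)`, with the monic form of `d^j(x^n - 1)`. -/
noncomputable def relationWord (lam : k) (n : ℕ) (t : ℕ × Word Unit) : Poly k Unit :=
  monicRelation lam n t.1 * ofWord t.2

/-- The leading word of `relationWord`. -/
noncomputable def relationLead (n : ℕ) (t : ℕ × Word Unit) : Word Unit :=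
  Finsupp.single (letter () t.1) n + t.2

/-- The combinations of elements `d^j(x^n - 1) · u` with leading words smaller than `w`. -/
noncomputable def below (lam : k) (n : ℕ) (w : Word Unit) : Submodule k (Poly k Unit) :=
  spanBelow k lt (relationLead n) (relationWord lam n) w

theorem relationWord_mem_below {u w : Word Unit} {j : ℕ}
    (h : lt (Finsupp.single (letter () j) n + u) w) :
    monicRelation lam n j * ofWord u ∈ below lam n w :=
  Submodule.subset_span ⟨(j, u), h, rfl⟩

/-- The difference of two multiples of relations with the same leading word is trivial, because the
leading words of different relations are coprime. -/
theorem relationWord_sub_mem_below (hl : lam ≠ 0) (hn : 1 ≤ n) (t t' : ℕ × Word Unit)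
    (h : relationLead n t = relationLead n t') :
    relationWord lam n t - relationWord lam n t' ∈ below lam n (relationLead n t) := by
  obtain ⟨i, u⟩ := t
  obtain ⟨j, v⟩ := t'
  simp only [relationLead] at h
  by_cases hij : i = j
  · subst hij
    rw [add_left_cancel h, sub_self]
    exact Submodule.zero_mem _
  · have hlet : letter () i ≠ letter () j := fun h =>
      hij (congrArg (fun a : Letter Unit => (ofLex a).1) h)
    -- Powers of different letters are coprime: the exponent of x^(j) on the right is at least `n`
    -- and must come entirely from `u`.
    obtain ⟨c, rfl⟩ : ∃ c, u = Finsupp.single (letter () j) n + c := by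
      refine ⟨u - Finsupp.single (letter () j) n, (add_tsub_cancel_of_le ?_).symm⟩
      rw [Finsupp.single_le_iff]
      have := DFunLike.congr_fun h (letter () j)
      rw [Finsupp.add_apply, Finsupp.add_apply, Finsupp.single_eq_same,
        Finsupp.single_eq_of_ne hlet.symm] at this
      omega
    have hv : v = Finsupp.single (letter () i) n + c := by
      rw [add_left_comm] at h
      exact (add_left_cancel h).symm
    subst hv
    obtain ⟨N, hN⟩ : ∃ N, N = below lam n
        (Finsupp.single (letter () i) n + (Finsupp.single (letter () j) n + c)) := ⟨_, rfl⟩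
    change _ ∈ below lam n (Finsupp.single (letter () i) n + (Finsupp.single (letter () j) n + c))
    rw [← hN]
    -- As for disjoint words, with F, G the monic relations and F', G' their leading words: F G' c -
    -- G F' c = G c (F - F') - F c (G - G').
    have h1 : monicRelation lam n i * ofWord c *
        (monicRelation lam n j - ofWord (Finsupp.single (letter () j) n)) ∈ N := by
      refine mul_mem_of_forall_word (fun w hw => ?_) (monicRelation_sub_mem hl hn j)
      rw [mul_assoc, ← ofWord_add, hN]
      refine relationWord_mem_below (lt_add_left ?_ _)
      rw [add_comm (Finsupp.single (letter () j) n) c]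
      exact lt_add_left hw c
    have h2 : monicRelation lam n j * ofWord c *
        (monicRelation lam n i - ofWord (Finsupp.single (letter () i) n)) ∈ N := by
      refine mul_mem_of_forall_word (fun w hw => ?_) (monicRelation_sub_mem hl hn i)
      rw [mul_assoc, ← ofWord_add, hN]
      refine relationWord_mem_below ?_
      rw [add_left_comm (Finsupp.single (letter () i) n), add_comm (Finsupp.single (letter () i) n) c]
      exact lt_add_left (lt_add_left hw c) _
    convert N.sub_mem h2 h1 using 1
    simp only [relationWord, ofWord_add]
    ring

theorem trivialMod_of_mem_below (hl : lam ≠ 0) (hn : 1 ≤ n) {w : Word Unit} {h : Poly k Unit}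
    (hh : h ∈ below lam n w) : TrivialMod lam (cyclicSet k n) w h := by
  refine Submodule.span_le.2 ?_ hh
  rintro _ ⟨⟨j, u⟩, hlt, rfl⟩
  rw [SetLike.mem_coe, relationWord, monicRelation, smul_mul_assoc]
  exact Submodule.smul_mem _ _ (Submodule.subset_span
    ⟨relation k n, rfl, j, _, u, (isLeadingWord_relation_iff hl hn).2 rfl, hlt, rfl⟩)

theorem isGroebnerShirshovBasis_cyclicSet (hl : lam ≠ 0) (hn : 1 ≤ n) :
    IsGroebnerShirshovBasis lam (cyclicSet k n) where
  monic := by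
    rintro _ rfl
    have h1 := (isLeadingWord_relation_iff (k := k) hl hn (m := 0)).2 rfl
    have h2 := coeff_relation hl hn 0
    rw [pow_zero, Module.End.one_apply] at h1 h2
    refine ⟨_, h1, h2.trans ?_⟩
    simp
  composition := by
    rintro _ rfl _ rfl i j f₀ g₀ p q u v w - - hp hq hw hw' -
    change IsLeadingWord ((deriv lam ^ i) (relation k n)) p at hp
    change IsLeadingWord ((deriv lam ^ j) (relation k n)) q at hq
    change TrivialMod lam _ w ((((deriv lam ^ i) (relation k n)).coeff p)⁻¹ •
      (deriv lam ^ i) (relation k n) * ofWord u -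
        (((deriv lam ^ j) (relation k n)).coeff q)⁻¹ • (deriv lam ^ j) (relation k n) * ofWord v)
    rw [isLeadingWord_relation_iff hl hn] at hp hq
    subst hp hq hw
    rw [coeff_relation hl hn, coeff_relation hl hn, ← monicRelation, ← monicRelation]
    exact trivialMod_of_mem_below hl hn (relationWord_sub_mem_below hl hn (i, u) (j, v) hw')

theorem DIrr_cyclicSet (hl : lam ≠ 0) (hn : 1 ≤ n) : DIrr lam (cyclicSet k n) =
    {w | ∀ t, relationLead n t ≠ w} := by
  ext w
  constructor
  · rintro h ⟨j, u⟩ rfl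
    exact h ⟨relation k n, rfl, j, _, u, (isLeadingWord_relation_iff hl hn).2 rfl, rfl⟩
  · rintro h ⟨_, rfl, j, l, u, hlead, rfl⟩
    exact h (j, u) (by rw [(isLeadingWord_relation_iff hl hn).1 hlead]; rfl)

theorem DIrr_cyclicSet_eq_lt (hl : lam ≠ 0) (hn : 1 ≤ n) : DIrr lam (cyclicSet k n) =
    {w | ∀ i : ℕ, w (letter () i) < n} := by
  rw [DIrr_cyclicSet hl hn]
  ext w
  constructor
  · intro h i
    by_contra hlt
    exact h (i, w - Finsupp.single (letter () i) n)
      (add_tsub_cancel_of_le (Finsupp.single_le_iff.2 (not_lt.1 hlt)))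
  · rintro h ⟨j, u⟩ rfl
    have := h j
    simp [relationLead] at this

theorem restrictScalars_differentialIdeal_cyclicSet (hl : lam ≠ 0) (n : ℕ) :
    (differentialIdeal (deriv₁ lam) (cyclicSet k n)).restrictScalars k =
      Submodule.span k (Set.range (relationWord lam n)) := by
  rw [(isWeightedDerivation_deriv lam).restrictScalars_differentialIdeal]
  apply le_antisymm
  · refine Submodule.span_le.2 ?_
    rintro _ ⟨_, rfl, m, a, b, rfl⟩
    change a * (deriv lam ^ m) (relation k n) * b ∈ _
    have hab : a * b ∈ Submodule.span k (ofWord '' (Set.univ : Set (Word Unit))) :=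
      mem_span_ofWord.2 fun _ _ => trivial
    rw [mul_right_comm, mul_comm]
    refine mul_mem_of_forall_word (fun w _ => ?_) hab
    rw [pow_deriv_relation_eq_smul hl, smul_mul_assoc]
    exact Submodule.smul_mem _ _ (Submodule.subset_span ⟨(m, w), rfl⟩)
  · refine Submodule.span_le.2 ?_
    rintro _ ⟨⟨j, u⟩, rfl⟩
    rw [SetLike.mem_coe, relationWord, monicRelation, smul_mul_assoc]
    refine Submodule.smul_mem _ _ (Submodule.subset_span ⟨relation k n, rfl, j, 1, ofWord u, ?_⟩)
    rw [one_mul]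

theorem relationWord_sub_mem (hl : lam ≠ 0) (hn : 1 ≤ n) (t : ℕ × Word Unit) :
    relationWord lam n t - (1 : k) • ofWord (relationLead n t) ∈
      Submodule.span k (ofWord '' {w | lt w (relationLead n t)}) := by
  rw [one_smul, relationWord, relationLead, ofWord_add, ← sub_mul, mul_comm, add_comm]
  refine mul_mem_of_forall_word (fun w hw => ?_) (monicRelation_sub_mem hl hn t.1)
  rw [← ofWord_add]
  exact Submodule.subset_span ⟨_, lt_add_left hw _, rfl⟩

theorem isBasisFamily_DIrr (hl : lam ≠ 0) (hn : 1 ≤ n) :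
    IsBasisFamily k fun w : DIrr lam (cyclicSet k n) =>
      toQuotient lam n (ofWord (w : Word Unit)) :=
  isBasisFamily_of_confluent wellFounded_lt (MvPolynomial.basisMonomials (Letter Unit) k).repr
    (fun t => coeff_eq_of_sub_mem (relationWord_sub_mem hl hn t))
    (fun t _ hv hne => lt_of_sub_mem (relationWord_sub_mem hl hn t) hv hne)
    (relationWord_sub_mem_below hl hn) (toQuotient lam n).toLinearMap
    (toDiffQuotient_surjective _ _)
    ((ker_toDiffQuotient _ _).trans (restrictScalars_differentialIdeal_cyclicSet hl n))
    (DIrr_cyclicSet hl hn)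

end Confluence

end Comm

/-- Since `d 1 = 0`, the constant survives only in the derivative of order 0, which is the origin of
the Kronecker delta. -/
theorem setOf_pow_cyclic_eq_range {k R : Type*} [Field k] [Ring R] [Algebra k R] {lam : k}
    {d : R →ₗ[k] R} (hd : IsWeightedDerivation lam d) (a : R) :
    {p | ∃ u ∈ ({a - 1} : Set R), ∃ m : ℕ, p = (d ^ m) u} =
      Set.range fun m : ℕ => (d ^ m) a - if m = 0 then 1 else 0 := by
  have h : ∀ m : ℕ, (d ^ m) (a - 1) = (d ^ m) a - if m = 0 then 1 else 0 := by
    intro m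
    cases m with
    | zero => rw [pow_zero, if_pos rfl]; rfl
    | succ m =>
      rw [map_sub, pow_succ, Module.End.mul_apply, Module.End.mul_apply, hd.map_one, map_zero,
        if_neg (Nat.succ_ne_zero m)]
  ext p
  constructor
  · rintro ⟨_, rfl, m, rfl⟩
    exact ⟨m, (h m).symm⟩
  · rintro ⟨m, rfl⟩
    exact ⟨_, rfl, m, (h m).symm⟩

theorem NC.differentialIdeal_cyclicSet {k : Type*} [Field k] (lam : k) (n : ℕ) :
    differentialIdeal (NC.deriv₁ lam) (NC.cyclicSet k n) =
      (TwoSidedIdeal.span (Set.range fun m : ℕ =>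
        (NC.deriv₁ lam ^ m) (NC.var k () 0 ^ n) - if m = 0 then 1 else 0)).asIdeal := by
  rw [(NC.isWeightedDerivation_deriv lam).differentialIdeal_eq_asIdeal_span, NC.cyclicSet,
    setOf_pow_cyclic_eq_range (NC.isWeightedDerivation_deriv lam)]

theorem asIdeal_span_eq_span {R : Type*} [CommRing R] (s : Set R) :
    (TwoSidedIdeal.span s).asIdeal = Ideal.span s := by
  apply le_antisymm
  · have : TwoSidedIdeal.span s ≤ (Ideal.span s).toTwoSided := by
      rw [TwoSidedIdeal.span_le]
      exact fun x hx => Ideal.mem_toTwoSided.2 (Ideal.subset_span hx)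
    exact fun x hx => Ideal.mem_toTwoSided.1 (this hx)
  · exact Ideal.span_le.2 TwoSidedIdeal.subset_span

theorem Comm.differentialIdeal_cyclicSet {k : Type*} [Field k] (lam : k) (n : ℕ) :
    differentialIdeal (Comm.deriv₁ lam) (Comm.cyclicSet k n) =
      Ideal.span (Set.range fun m : ℕ =>
        (Comm.deriv₁ lam ^ m) (Comm.var k () 0 ^ n) - if m = 0 then 1 else 0) := by
  rw [(Comm.isWeightedDerivation_deriv lam).differentialIdeal_eq_asIdeal_span, Comm.cyclicSet,
    setOf_pow_cyclic_eq_range (Comm.isWeightedDerivation_deriv lam), asIdeal_span_eq_span]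

end DiffGS

/-- The quotient lies in `Type u` and a given free object `F` in `Type z`. To be compared with the
quotient, `F` must be tested against algebras in both universes, hence `max u z`. The quotient
itself is free with respect to test algebras in any universe `v`. -/
theorem mainTheorem10 {k : Type u} [Field k] [CharZero k] [DecidableEq k] (lam : k) (n : ℕ)
    (hn : 2 ≤ n) {G : Type w} [Group G] (hG : Nat.card G = n) (g : G)
    (hg : ∀ h : G, h ∈ Subgroup.zpowers g) :
    -- the free differential algebra of weight `lam` on the group algebra of the cyclic group `G`
    ((∃ i : MonoidAlgebra k G →ₐ[k] NC.CyclicQuotient lam n,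
        i (MonoidAlgebra.of k G g) = NC.toQuotient lam n (NC.var k () 0) ∧
        IsFreeDifferentialAlgebra.{v} lam (NC.cyclicDeriv lam n) i) ∧
     (∀ (F : Type z) [Ring F] [Algebra k F] (dF : F →ₗ[k] F) (iF : MonoidAlgebra k G →ₐ[k] F),
        IsFreeDifferentialAlgebra.{max u z} lam dF iF →
        ∃ e : F ≃ₐ[k] NC.CyclicQuotient lam n,
          (∀ x, e (dF x) = NC.cyclicDeriv lam n (e x)) ∧
          e (iF (MonoidAlgebra.of k G g)) = NC.toQuotient lam n (NC.var k () 0)) ∧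
     differentialIdeal (NC.deriv₁ lam) (NC.cyclicSet k n) =
        (TwoSidedIdeal.span (Set.range fun m : ℕ =>
          (NC.deriv₁ lam ^ m) (NC.var k () 0 ^ n) - if m = 0 then 1 else 0)).asIdeal ∧
     NC.IsGroebnerShirshovBasis lam (NC.cyclicSet k n) ∧
     NC.DIrr lam (NC.cyclicSet k n) = {x | ∀ m : ℕ, ¬ NC.IsSubword
        (FreeMonoid.of (letter () m) *
          FreeMonoid.of (letter () (if lam = 0 then 0 else m)) ^ (n - 1)) x} ∧
     IsBasisFamily k (fun x : NC.DIrr lam (NC.cyclicSet k n) =>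
        NC.toQuotient lam n (NC.ofWord (x : NC.Word Unit)))) ∧
    -- the free commutative differential algebra of weight `lam` on the group algebra of `G`
    ((∃ i : MonoidAlgebra k G →ₐ[k] Comm.CyclicQuotient lam n,
        i (MonoidAlgebra.of k G g) = Comm.toQuotient lam n (Comm.var k () 0) ∧
        IsFreeCommDifferentialAlgebra.{v} lam (Comm.cyclicDeriv lam n) i) ∧
     (∀ (F : Type z) [CommRing F] [Algebra k F] (dF : F →ₗ[k] F)
        (iF : MonoidAlgebra k G →ₐ[k] F),
        IsFreeCommDifferentialAlgebra.{max u z} lam dF iF →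
        ∃ e : F ≃ₐ[k] Comm.CyclicQuotient lam n,
          (∀ x, e (dF x) = Comm.cyclicDeriv lam n (e x)) ∧
          e (iF (MonoidAlgebra.of k G g)) = Comm.toQuotient lam n (Comm.var k () 0)) ∧
     differentialIdeal (Comm.deriv₁ lam) (Comm.cyclicSet k n) =
        Ideal.span (Set.range fun m : ℕ =>
          (Comm.deriv₁ lam ^ m) (Comm.var k () 0 ^ n) - if m = 0 then 1 else 0) ∧
     (lam ≠ 0 →
       Comm.IsGroebnerShirshovBasis lam (Comm.cyclicSet k n) ∧
       Comm.DIrr lam (Comm.cyclicSet k n) = {x | ∀ i : ℕ, x (letter () i) < n} ∧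
       IsBasisFamily k (fun x : Comm.DIrr lam (Comm.cyclicSet k n) =>
          Comm.toQuotient lam n (Comm.ofWord (x : Comm.Word Unit))))) := by
  have hn1 : 1 ≤ n := by omega
  have hn0 : n ≠ 0 := by omega
  refine ⟨⟨?_, ?_, NC.differentialIdeal_cyclicSet lam n,
    NC.isGroebnerShirshovBasis_cyclicSet lam hn1, NC.DIrr_cyclicSet_eq_not_isSubword lam hn1,
    NC.isBasisFamily_DIrr lam hn1⟩, ?_, ?_, Comm.differentialIdeal_cyclicSet lam n,
    fun hl => ⟨Comm.isGroebnerShirshovBasis_cyclicSet hl hn1, Comm.DIrr_cyclicSet_eq_lt hl hn1,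
      Comm.isBasisFamily_DIrr hl hn1⟩⟩
  · obtain ⟨i, hi⟩ := exists_algHom_of_pow_eq_one (k := k) hG hg hn0 (NC.toQuotient_var_pow lam n)
    exact ⟨i, hi, NC.isFreeDifferentialAlgebra_cyclicQuotient hG hg hi⟩
  · intro F _ _ dF iF hF
    obtain ⟨i, hi⟩ := exists_algHom_of_pow_eq_one (k := k) hG hg hn0 (NC.toQuotient_var_pow lam n)
    -- Maps into the quotient need the universal property in universe `u`, maps into `F` need it in
    -- universe `z`.
    have hFu := IsFreeDifferentialAlgebra.lower.{u, u, z} hF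
    have hFz := IsFreeDifferentialAlgebra.lower.{u, z, u} hF
    have hEu := NC.isFreeDifferentialAlgebra_cyclicQuotient.{u} hG hg hi
    have hEz := NC.isFreeDifferentialAlgebra_cyclicQuotient.{z} hG hg hi
    obtain ⟨e, he, hei⟩ := exists_algEquiv_of_universal (hFz.universal F dF hF.derivation iF)
      (hFu.universal _ _ hEu.derivation i) (hEz.universal F dF hF.derivation iF)
      (hEu.universal _ _ hEu.derivation i)
    exact ⟨e, he, (hei _).trans hi⟩
  · obtain ⟨i, hi⟩ := exists_algHom_of_pow_eq_one (k := k) hG hg hn0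
      (Comm.toQuotient_var_pow lam n)
    exact ⟨i, hi, Comm.isFreeCommDifferentialAlgebra_cyclicQuotient hG hg hi⟩
  · intro F _ _ dF iF hF
    obtain ⟨i, hi⟩ := exists_algHom_of_pow_eq_one (k := k) hG hg hn0
      (Comm.toQuotient_var_pow lam n)
    have hFu := IsFreeCommDifferentialAlgebra.lower.{u, u, z} hF
    have hFz := IsFreeCommDifferentialAlgebra.lower.{u, z, u} hF
    have hEu := Comm.isFreeCommDifferentialAlgebra_cyclicQuotient.{u} hG hg hi
    have hEz := Comm.isFreeCommDifferentialAlgebra_cyclicQuotient.{z} hG hg hi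
    obtain ⟨e, he, hei⟩ := exists_algEquiv_of_universal (hFz.universal F dF hF.derivation iF)
      (hFu.universal _ _ hEu.derivation i) (hEz.universal F dF hF.derivation iF)
      (hEu.universal _ _ hEu.derivation i)
    exact ⟨e, he, (hei _).trans hi⟩
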